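/- Let $\mathcal N$ be a $W^*$-algebra of type $I_2$, i.e. a unital $C^*$-algebra which is (isometrically and linearly identified with) the dual $X^*$ of a complex Banach space $X$, and whose unit is the sum of two orthogonal, Murray–von Neumann equivalent, abelian projections (up to $*$-isomorphism, $\mathcal N=\mathcal M\otimes M_2$ with $\mathcal M$ a commutative $W^*$-algebra and $M_2$ the complex $2\times 2$ matrices). Let $H$ be a complex Hilbert space, with inner product linear in the first argument, and let $F:\mathcal N\to H$ be a $w^*$-continuous orthogonal vector field, i.e. a linear map which is continuous from the $w^*$-topology $\sigma(\mathcal N,X)$ to the weak topology of $H$ and satisfies $\langle F(p),F(q)\rangle=0$ for all (self-adjoint) projections $p,q\in\mathcal N$ with $pq=0$. Then $F$ is stationary: there are positive functionals $\varphi,\psi$ in the predual of $\mathcal N$ (that is, normal positive functionals, given by evaluation at elements of $X$) such that $$\langle F(x),F(y)\rangle=\varphi(y^*x)+\psi(xy^*)\qquad\text{for all }x,y\in\mathcal N.$$ -/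

import Mathlib

open scoped ComplexOrder

/-- A projection `p` of a C*-algebra is abelian if the corner `p N p` is commutative. -/
def IsAbelianProjection {N : Type*} [CStarAlgebra N] (p : N) : Prop :=
  IsStarProjection p ∧ ∀ x y : N, Commute (p * x * p) (p * y * p)

/-- Murray-von Neumann equivalence: `p = v* v` and `q = v v*` for some `v`. -/
def IsEquivalentProjection {N : Type*} [CStarAlgebra N] (p q : N) : Prop :=
  ∃ v : N, star v * v = p ∧ v * star v = q

/-- Type `I_2`: the unit is the sum of two orthogonal equivalent abelian projections. -/
def IsTypeITwo (N : Type*) [CStarAlgebra N] : Prop :=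
  ∃ p q : N, IsAbelianProjection p ∧ IsAbelianProjection q ∧ IsEquivalentProjection p q ∧
    p * q = 0 ∧ p + q = 1

section

variable {N X H : Type*} [CStarAlgebra N]
  [NormedAddCommGroup X] [NormedSpace ℂ X]
  [NormedAddCommGroup H] [InnerProductSpace ℂ H]

/-- The weak* topology `σ(N, X)` on `N` given by a predual `X` of `N`, that is, by an isometric
linear identification `e` of `N` with the Banach dual of `X`. -/
@[reducible]
noncomputable def weakStarTopology (e : N ≃ₗᵢ[ℂ] StrongDual ℂ X) : TopologicalSpace N :=
  TopologicalSpace.induced (fun x : N => StrongDual.toWeakDual (e x)) inferInstance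

/-- `F` is continuous from the weak* topology of `N` to the weak topology of `H`. -/
def IsWStarContinuous (e : N ≃ₗᵢ[ℂ] StrongDual ℂ X) (F : N →ₗ[ℂ] H) : Prop :=
  @Continuous N (WeakSpace ℂ H) (weakStarTopology e) inferInstance
    (fun x : N => toWeakSpace ℂ H (F x))

/-- `F` maps orthogonal projections to orthogonal vectors. -/
def IsOrthogonalField (F : N →ₗ[ℂ] H) : Prop :=
  ∀ p q : N, IsStarProjection p → IsStarProjection q → p * q = 0 → inner ℂ (F p) (F q) = 0

/-- `φ` is a normal positive functional: it is positive and belongs to the predual, i.e. it is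
the evaluation at some element of `X`. -/
def IsNormalPositive (e : N ≃ₗᵢ[ℂ] StrongDual ℂ X) (φ : StrongDual ℂ N) : Prop :=
  (∃ ξ : X, ∀ x : N, φ x = e x ξ) ∧ ∀ x : N, 0 ≤ φ (star x * x)

/-- Stationarity, `⟨F x, F y⟩ = φ (y* x) + ψ (x y*)` with normal positive `φ`, `ψ`. The inner
product of the formula is linear in its first argument, so it is `inner ℂ (F y) (F x)` here. -/
def IsStationaryField (e : N ≃ₗᵢ[ℂ] StrongDual ℂ X) (F : N →ₗ[ℂ] H) : Prop :=
  ∃ φ ψ : StrongDual ℂ N, IsNormalPositive e φ ∧ IsNormalPositive e ψ ∧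
    ∀ x y : N, inner ℂ (F y) (F x) = φ (star y * x) + ψ (x * star y)

end

/-!
Put `β x y = ⟨F x, F (y*)⟩`, a bounded bilinear form on `N` that vanishes on pairs of orthogonal
projections, and let `ω x = β x 1`, a normal functional. The argument has an analytic and an
algebraic half.

*The predual.* Everything that is needed about W*-algebras is derived from the isometric predual.
Bounded weak* limits of selfadjoint or positive elements are again selfadjoint or positive, so a
bounded increasing sequence has a supremum, and the supremum of suitable functions of `a` is a
spectral projection of `a` (`exists_spectral_projection`). Hence selfadjoint elements are norm
limits of combinations of projections commuting with whatever they commute with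
(`mem_of_forall_isStarProjection`). Left multiplication by a projection preserves normality because
the limit of a bounded family in `p N` stays in `p N`; by density `x ↦ ω (h x)` is normal for all
`h` (`comp_mul_mem_normalFunctionals`), and a positive functional below a normal one is normal
(`exists_mem_normalFunctionals_of_le`).

*The form.* On commuting selfadjoint elements `β x y = ω (x y)`. Therefore
`γ x y = β x y - ω (x y + y x) / 2` is skew-symmetric, vanishes on commuting selfadjoint pairs, and
satisfies `γ (z x) y = γ x (z y)` for central `z`. In type `I₂` every element is a combination of
`1` and three matrix units with central coefficients, and such a `γ` is of the form
`τ (y x - x y) / 2` (`IsTwoByTwoSystem.exists_apply_commutator`). This gives functionals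
`φ₀ = (ω + τ) / 2` and `ψ₀ = (ω - τ) / 2` with `⟨F x, F y⟩ = φ₀ (y* x) + ψ₀ (x y*)`, where nothing is
known about positivity and normality of `φ₀` and `ψ₀`.

*Positivity.* Only the values `φ₀ b + ψ₀ a` on pairs `(b, a)` with the same center-valued trace
matter. They are nonnegative for `a, b ≥ 0`: if `t` is the common trace, summing
`‖F (a^(1/2) w b^(1/2) t^(-1/2))‖² ≥ 0` over the matrix units `w` gives exactly `φ₀ b + ψ₀ a`. The
M. Riesz extension theorem then replaces `φ₀`, `ψ₀` by positive `φ`, `ψ`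
(`IsTwoByTwoSystem.exists_nonneg_functionals`). They satisfy `φ + ψ = ω`, so both are normal.
-/

open Filter Topology
open scoped ComplexStarModule

/-! ### The predual and weak* convergence -/

section Predual

variable {N X : Type*} [CStarAlgebra N] [NormedAddCommGroup X] [NormedSpace ℂ X]

/-- `u` converges to `a` along `l` in the weak* topology `σ(N, X)`, spelled out on the elements of
the predual. -/
def WStarTendsto {ι : Type*} (e : N ≃ₗᵢ[ℂ] StrongDual ℂ X) (u : ι → N) (l : Filter ι) (a : N) :
    Prop :=
  ∀ ξ : X, Tendsto (fun i => e (u i) ξ) l (𝓝 (e a ξ))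

/-- Evaluation at the elements of the predual, as an isometric embedding of `X` in the dual
of `N`. -/
noncomputable def predualEmbedding (e : N ≃ₗᵢ[ℂ] StrongDual ℂ X) : X →ₗᵢ[ℂ] StrongDual ℂ N where
  toFun ξ := (NormedSpace.inclusionInDoubleDual ℂ X ξ).comp
    (e.toContinuousLinearEquiv : N →L[ℂ] StrongDual ℂ X)
  map_add' ξ η := by ext x; simp
  map_smul' c ξ := by ext x; simp
  norm_map' ξ := (ContinuousLinearMap.opNorm_comp_linearIsometryEquiv _ e).trans
    ((NormedSpace.inclusionInDoubleDualLi (𝕜 := ℂ)).norm_map ξ)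

/-- The predual as a subspace of the dual of `N`: the functionals that are evaluations at elements
of `X`. -/
noncomputable def normalFunctionals (e : N ≃ₗᵢ[ℂ] StrongDual ℂ X) :
    Submodule ℂ (StrongDual ℂ N) :=
  LinearMap.range (predualEmbedding e).toLinearMap

variable {e : N ≃ₗᵢ[ℂ] StrongDual ℂ X}

theorem mem_normalFunctionals {φ : StrongDual ℂ N} :
    φ ∈ normalFunctionals e ↔ ∃ ξ : X, ∀ x : N, φ x = e x ξ := by
  constructor
  · rintro ⟨ξ, rfl⟩
    exact ⟨ξ, fun x => rfl⟩
  · rintro ⟨ξ, h⟩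
    exact ⟨ξ, ContinuousLinearMap.ext fun x => (h x).symm⟩

theorem isClosed_normalFunctionals [CompleteSpace X] :
    IsClosed (normalFunctionals e : Set (StrongDual ℂ N)) :=
  (predualEmbedding e).isometry.isClosedEmbedding.isClosed_range

namespace WStarTendsto

variable {ι : Type*} {u w : ι → N} {l : Filter ι} {a b : N}

theorem add (hu : WStarTendsto e u l a) (hw : WStarTendsto e w l b) :
    WStarTendsto e (fun i => u i + w i) l (a + b) := fun ξ => by
  simpa using (hu ξ).add (hw ξ)

theorem sub (hu : WStarTendsto e u l a) (hw : WStarTendsto e w l b) :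
    WStarTendsto e (fun i => u i - w i) l (a - b) := fun ξ => by
  simpa using (hu ξ).sub (hw ξ)

theorem const (a : N) : WStarTendsto e (fun _ : ι => a) l a := fun _ => tendsto_const_nhds

theorem unique [l.NeBot] (hu : WStarTendsto e u l a) (hw : WStarTendsto e u l b) : a = b :=
  e.injective <| ContinuousLinearMap.ext fun ξ => tendsto_nhds_unique (hu ξ) (hw ξ)

theorem congr (hu : WStarTendsto e u l a) (h : ∀ᶠ i in l, u i = w i) : WStarTendsto e w l a :=
  fun ξ => (hu ξ).congr' (h.mono fun i hi => by simp [hi])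

theorem of_tendsto (hu : Tendsto u l (𝓝 a)) : WStarTendsto e u l a := fun ξ => by
  have : Continuous fun x : N => e x ξ :=
    (ContinuousLinearMap.apply ℂ ℂ ξ).continuous.comp e.continuous
  exact (this.tendsto a).comp hu

theorem norm_le [l.NeBot] (hu : WStarTendsto e u l a) {C : ℝ} (hC : 0 ≤ C)
    (h : ∀ᶠ i in l, ‖u i‖ ≤ C) : ‖a‖ ≤ C := by
  rw [← e.norm_map]
  refine ContinuousLinearMap.opNorm_le_bound _ hC fun ξ => ?_
  refine le_of_tendsto (hu ξ).norm (h.mono fun i hi => ?_)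
  refine ((e (u i)).le_opNorm ξ).trans ?_
  rw [e.norm_map]
  gcongr

/-- Banach-Alaoglu, along an ultrafilter. -/
theorem exists_of_bounded (U : Ultrafilter ι) {C : ℝ} (h : ∀ᶠ i in (U : Filter ι), ‖u i‖ ≤ C) :
    ∃ a : N, WStarTendsto e u U a := by
  have hK := WeakDual.isCompact_closedBall (𝕜 := ℂ) (E := X) 0 C
  obtain ⟨f, -, hf⟩ := hK.ultrafilter_le_nhds (U.map fun i => StrongDual.toWeakDual (e (u i)))
    (by
      simp only [le_principal_iff, Ultrafilter.mem_coe, Ultrafilter.mem_map]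
      filter_upwards [h] with i hi
      simpa using hi)
  refine ⟨e.symm (WeakDual.toStrongDual f), fun ξ => ?_⟩
  have := ((WeakDual.eval_continuous (𝕜 := ℂ) ξ).tendsto f).comp hf
  simpa using! this

end WStarTendsto

/-- A functional that is weak* continuous on the unit ball is normal (a form of the Krein-Šmulian
theorem). Given `ε`, such a functional is at most `ε` on the unit ball of a finite intersection of
kernels of elements of `X`; removing a Hahn-Banach extension of norm at most `ε` of its restriction
leaves a combination of these elements. -/
theorem mem_normalFunctionals_of_ultrafilter [CompleteSpace X] (f : StrongDual ℂ N)
    (hf : ∀ U : Ultrafilter N, (∀ᶠ x in (U : Filter N), ‖x‖ ≤ 1) → WStarTendsto e id U 0 →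
      Tendsto f U (𝓝 0)) :
    f ∈ normalFunctionals e := by
  rw [← SetLike.mem_coe, ← isClosed_normalFunctionals.closure_eq, Metric.mem_closure_iff]
  intro ε hε
  have hl : Tendsto f (comap (fun x : N => fun ξ : X => e x ξ) (𝓝 0) ⊓ 𝓟 {x | ‖x‖ ≤ 1})
      (𝓝 0) := by
    rw [tendsto_iff_ultrafilter]
    intro U hU
    refine hf U (le_principal_iff.1 (hU.trans inf_le_right)) fun ξ => ?_
    have h1 := tendsto_iff_comap.2 (hU.trans inf_le_left)
    simpa using tendsto_pi_nhds.1 h1 ξ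
  have h2 := hl.eventually (Metric.ball_mem_nhds 0 (half_pos hε))
  rw [eventually_inf_principal, eventually_comap] at h2
  rw [nhds_pi, Filter.Eventually, Filter.mem_pi] at h2
  obtain ⟨I, hI, t, ht, hsub⟩ := h2
  let W : Submodule ℂ N := ⨅ ξ : I, LinearMap.ker
    ((ContinuousLinearMap.apply ℂ ℂ (ξ : X) : StrongDual ℂ X →ₗ[ℂ] ℂ) ∘ₗ
      (e.toLinearEquiv : N →ₗ[ℂ] _))
  have hW : ∀ x ∈ W, ‖x‖ ≤ 1 → ‖f x‖ ≤ ε / 2 := by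
    intro x hx hx1
    have hmem : (fun ξ : X => e x ξ) ∈ I.pi t := by
      intro ξ hξ
      have : e x ξ = 0 := by
        simpa using! (Submodule.mem_iInf _).1 hx ⟨ξ, hξ⟩
      change e x ξ ∈ t ξ
      rw [this]
      exact mem_of_mem_nhds (ht ξ)
    have := hsub hmem x rfl hx1
    rw [dist_zero_right] at this
    exact this.le
  obtain ⟨g, hg, hgn⟩ := exists_extension_norm_eq W (f.comp W.subtypeL)
  have hgn' : ‖g‖ ≤ ε / 2 := by
    rw [hgn]
    refine ContinuousLinearMap.opNorm_le_of_unit_norm (𝕜 := ℂ) (half_pos hε).le ?_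
    intro x hx
    exact hW x x.2 (by simpa using! hx.le)
  refine ⟨f - g, ?_, ?_⟩
  · have : (f - g : N →ₗ[ℂ] ℂ) ∈ Submodule.span ℂ (Set.range fun ξ : I =>
        ((ContinuousLinearMap.apply ℂ ℂ (ξ : X) : StrongDual ℂ X →ₗ[ℂ] ℂ) ∘ₗ
          (e.toLinearEquiv : N →ₗ[ℂ] _))) := by
      have := hI.to_subtype
      refine mem_span_of_iInf_ker_le_ker fun x hx => ?_
      have := hg ⟨x, hx⟩
      simpa [sub_eq_zero] using! this.symm
    have key : ∀ h : N →ₗ[ℂ] ℂ, h ∈ Submodule.span ℂ (Set.range fun ξ : I =>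
        ((ContinuousLinearMap.apply ℂ ℂ (ξ : X) : StrongDual ℂ X →ₗ[ℂ] ℂ) ∘ₗ
          (e.toLinearEquiv : N →ₗ[ℂ] _))) → ∃ ξ : X, ∀ x, h x = e x ξ := by
      intro h hh
      induction hh using Submodule.span_induction with
      | mem h hh => obtain ⟨ξ, rfl⟩ := hh; exact ⟨ξ, fun x => rfl⟩
      | zero => exact ⟨0, by simp⟩
      | add h k _ _ h1 h2 =>
        obtain ⟨ξ, h1⟩ := h1
        obtain ⟨η, h2⟩ := h2
        exact ⟨ξ + η, fun x => by simp [h1, h2]⟩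
      | smul c h _ h1 =>
        obtain ⟨ξ, h1⟩ := h1
        exact ⟨c • ξ, fun x => by simp [h1]⟩
    exact mem_normalFunctionals.2 (key _ this)
  · rw [dist_eq_norm, sub_sub_cancel]
    linarith

end Predual

/-! ### Weak* limits in a C*-algebra with a predual -/

section Projections

variable {N X : Type*} [CStarAlgebra N] [NormedAddCommGroup X] [NormedSpace ℂ X]
  {e : N ≃ₗᵢ[ℂ] StrongDual ℂ X}

namespace WStarTendsto

variable {ι : Type*} {u : ι → N} {l : Filter ι} {a : N}

/-- A bounded weak* limit of selfadjoint elements is selfadjoint. If `b` is the imaginary part of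
the limit, then `‖b + t‖² ≤ C² + t²` for every real `t`, so the spectrum of `b` is `{0}`. -/
theorem isSelfAdjoint [l.NeBot] (hu : WStarTendsto e u l a) {C : ℝ}
    (hC : ∀ᶠ i in l, ‖u i‖ ≤ C) (h : ∀ᶠ i in l, IsSelfAdjoint (u i)) : IsSelfAdjoint a := by
  cases subsingleton_or_nontrivial N
  · exact Subsingleton.elim _ _
  have hC0 : 0 ≤ C := by
    obtain ⟨i, hi⟩ := hC.exists
    exact (norm_nonneg _).trans hi
  have key : ∀ t : ℝ, ‖a + (Complex.I * t) • (1 : N)‖ ≤ √(C ^ 2 + t ^ 2) := by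
    intro t
    refine (hu.add (const ((Complex.I * t) • (1 : N)))).norm_le (Real.sqrt_nonneg _) ?_
    filter_upwards [hC, h] with i hi hsa
    refine Real.le_sqrt_of_sq_le ?_
    have h1 : star (u i + (Complex.I * t) • (1 : N)) * (u i + (Complex.I * t) • (1 : N)) =
        u i * u i + ((t ^ 2 : ℝ) : ℂ) • (1 : N) := by
      simp only [star_add, hsa.star_eq, star_smul, star_one, star_mul', Complex.star_def,
        Complex.conj_I, Complex.conj_ofReal, add_mul, mul_add, smul_mul_assoc, mul_smul_comm,
        one_mul, mul_one]
      have : Complex.I * t * (-Complex.I * t) = ((t ^ 2 : ℝ) : ℂ) := by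
        push_cast; linear_combination (-(t : ℂ) ^ 2) * Complex.I_sq
      rw [← this]
      module
    have h2 : ‖u i * u i + ((t ^ 2 : ℝ) : ℂ) • (1 : N)‖ ≤ C ^ 2 + t ^ 2 := by
      refine (norm_add_le _ _).trans (add_le_add ?_ ?_)
      · rw [pow_two]; exact (norm_mul_le _ _).trans (mul_le_mul hi hi (norm_nonneg _) hC0)
      · rw [norm_smul, Complex.norm_real, Real.norm_of_nonneg (sq_nonneg t), norm_one, mul_one]
    rw [pow_two ‖_‖, ← CStarRing.norm_star_mul_self, h1]
    exact h2
  have him : (ℑ a : N) = 0 := by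
    refine CFC.eq_zero_of_spectrum_subset_zero (R := ℝ) _ (fun r hr => ?_) (ℑ a).2
    have hle : ∀ t : ℝ, (t + r) ^ 2 ≤ C ^ 2 + t ^ 2 := by
      intro t
      have h1 : t + r ∈ spectrum ℝ (algebraMap ℝ N t + (ℑ a : N)) := by
        rw [add_comm t r]
        exact spectrum.add_mem_add_iff.2 hr
      have h2 : algebraMap ℝ N t + (ℑ a : N) = ℑ (a + (Complex.I * t) • (1 : N)) := by
        simp [imaginaryPart_smul, Algebra.algebraMap_eq_smul_one, add_comm]
      have h3 := (imaginaryPart.norm_le (a + (Complex.I * t) • (1 : N))).trans (key t)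
      have h4 : |t + r| ≤ √(C ^ 2 + t ^ 2) := by
        refine (spectrum.norm_le_norm_of_mem h1).trans ?_
        rw [h2]
        exact h3
      exact (sq_abs (t + r)) ▸ (Real.le_sqrt (abs_nonneg _) (by positivity)).1 h4
    by_contra hr0
    have h1 := hle ((C ^ 2 + 1) / (2 * r))
    have h2 : 2 * ((C ^ 2 + 1) / (2 * r)) * r = C ^ 2 + 1 := by
      field_simp [show r ≠ 0 from hr0]
    nlinarith [sq_nonneg r]
  exact imaginaryPart_eq_zero_iff.1 (Subtype.ext him)

/-- The weak* limit of a bounded family in `p N` is in `p N`. With `b = (1 - p) a`, the norm of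
`u i + n b` is at most `√(C² + n² ‖b‖²)` since the ranges are orthogonal, whereas that of the limit
`a + n b` is at least `(n + 1) ‖b‖`. -/
theorem projection_mul [l.NeBot] (hu : WStarTendsto e u l a) {C : ℝ}
    (hC : ∀ᶠ i in l, ‖u i‖ ≤ C) {p : N} (hp : IsStarProjection p)
    (h : ∀ᶠ i in l, p * u i = u i) : p * a = a := by
  have hC0 : 0 ≤ C := by
    obtain ⟨i, hi⟩ := hC.exists
    exact (norm_nonneg _).trans hi
  set b := (1 - p) * a with hb
  have hpb : (1 - p) * b = b := by
    rw [hb, ← mul_assoc, hp.one_sub.isIdempotentElem.eq]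
  have key : ∀ n : ℕ, ‖a + (n : ℂ) • b‖ ≤ √(C ^ 2 + n ^ 2 * ‖b‖ ^ 2) := by
    intro n
    refine (hu.add (const ((n : ℂ) • b))).norm_le (Real.sqrt_nonneg _) ?_
    filter_upwards [hC, h] with i hi hpu
    refine Real.le_sqrt_of_sq_le ?_
    have h0 : star (u i) * b = 0 := by
      rw [← hpu, ← hpb, star_mul, hp.isSelfAdjoint.star_eq, mul_assoc, ← mul_assoc p,
        hp.mul_one_sub_self, zero_mul, mul_zero]
    have h0' : star b * u i = 0 := by simpa using congrArg star h0
    have h1 : star (u i + (n : ℂ) • b) * (u i + (n : ℂ) • b) =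
        star (u i) * u i + ((n : ℂ) ^ 2) • (star b * b) := by
      simp only [star_add, star_smul, add_mul, mul_add, smul_mul_assoc, mul_smul_comm, h0, h0',
        smul_zero, star_natCast]
      module
    rw [pow_two ‖_‖, ← CStarRing.norm_star_mul_self, h1]
    refine (norm_add_le _ _).trans (add_le_add ?_ ?_)
    · rw [CStarRing.norm_star_mul_self, ← pow_two]
      gcongr
    · rw [norm_smul, CStarRing.norm_star_mul_self, ← pow_two]
      simp
  have hle : ∀ n : ℕ, (2 * n + 1) * ‖b‖ ^ 2 ≤ C ^ 2 := by
    intro n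
    have h1 : (1 - p) * (a + (n : ℂ) • b) = ((n + 1 : ℕ) : ℂ) • b := by
      rw [mul_add, mul_smul_comm, hpb, ← hb]
      push_cast
      module
    have h2 : ‖((n + 1 : ℕ) : ℂ) • b‖ ≤ √(C ^ 2 + n ^ 2 * ‖b‖ ^ 2) := by
      rw [← h1]
      refine (norm_mul_le _ _).trans ?_
      exact (mul_le_of_le_one_left (norm_nonneg _) hp.one_sub.norm_le).trans (key n)
    rw [norm_smul, Complex.norm_natCast, Real.le_sqrt (by positivity) (by positivity)] at h2
    push_cast at h2
    nlinarith
  have hb0 : b = 0 := by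
    by_contra hne
    have hpos : 0 < ‖b‖ ^ 2 := by positivity
    obtain ⟨n, hn⟩ := exists_nat_gt (C ^ 2 / ‖b‖ ^ 2)
    rw [div_lt_iff₀ hpos] at hn
    nlinarith [hle n]
  rw [hb, sub_mul, one_mul, sub_eq_zero] at hb0
  exact hb0.symm

variable [PartialOrder N] [StarOrderedRing N]

theorem nonneg [l.NeBot] (hu : WStarTendsto e u l a) {C : ℝ}
    (hC : ∀ᶠ i in l, ‖u i‖ ≤ C) (h : ∀ᶠ i in l, 0 ≤ u i) : 0 ≤ a := by
  have hC0 : 0 ≤ C := by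
    obtain ⟨i, hi⟩ := hC.exists
    exact (norm_nonneg _).trans hi
  lift C to NNReal using hC0
  rw [nonneg_iff_isSelfAdjoint_and_quasispectrumRestricts]
  have ha : IsSelfAdjoint a :=
    hu.isSelfAdjoint hC (h.mono fun i hi => IsSelfAdjoint.of_nonneg hi)
  refine ⟨ha, quasispectrumRestricts_iff_spectrumRestricts.2 ?_⟩
  rw [SpectrumRestricts.nnreal_iff_nnnorm ha (hu.norm_le C.2 hC)]
  refine ((const (algebraMap ℝ N C)).sub hu).norm_le C.2 ?_
  filter_upwards [hC, h] with i hi hpos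
  have hsa : IsSelfAdjoint (u i) := .of_nonneg hpos
  exact (SpectrumRestricts.nnreal_iff_nnnorm hsa hi).1 (.nnreal_of_nonneg hpos)

end WStarTendsto
end Projections

/-! ### Spectral projections -/

section SpectralProjections

variable {N X : Type*} [CStarAlgebra N] [NormedAddCommGroup X] [NormedSpace ℂ X]

/-- A selfadjoint element is a real multiple of `u + u*` for a unitary `u` that commutes with
everything that commutes with the element. -/
theorem commute_of_forall_unitary [PartialOrder N] [StarOrderedRing N] {p w : N}
    (hw : IsSelfAdjoint w)
    (h : ∀ u ∈ unitary N, (∀ y : N, Commute w y → Commute u y) → Commute u p) : Commute w p := by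
  obtain rfl | hw0 := eq_or_ne w 0
  · exact Commute.zero_left p
  set a : N := (‖w‖⁻¹ : ℂ) • w with ha
  have hasa : IsSelfAdjoint a := by
    rw [ha, IsSelfAdjoint, star_smul, hw.star_eq]; simp
  have han : ‖a‖ ≤ 1 := by
    rw [ha, norm_smul, norm_inv, Complex.norm_real, norm_norm,
      inv_mul_cancel₀ (norm_ne_zero_iff.2 hw0)]
  have hwa : w = (‖w‖ : ℂ) • a := by
    rw [ha, smul_smul, mul_inv_cancel₀, one_smul]
    exact_mod_cast norm_ne_zero_iff.2 hw0
  set s := CFC.sqrt (1 - a ^ 2) with hs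
  have hcomm : ∀ y : N, Commute w y → Commute a y ∧ Commute s y := by
    intro y hy
    have h1 : Commute a y := hy.smul_left _
    exact ⟨h1, ((Commute.one_left y).sub_left (h1.pow_left 2)).cfcₙ_nnreal _⟩
  have hu : a + Complex.I • s ∈ unitary N := hasa.self_add_I_smul_cfcSqrt_sub_sq_mem_unitary a han
  have hus : star (a + Complex.I • s) = a - Complex.I • s := by
    have hssa : IsSelfAdjoint s := (CFC.sqrt_nonneg _).isSelfAdjoint
    rw [star_add, hasa.star_eq, star_smul, hssa.star_eq]
    simp [sub_eq_add_neg]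
  have h1 := h _ hu fun y hy => (hcomm y hy).1.add_left ((hcomm y hy).2.smul_left _)
  have h2 := h _ (Unitary.star_mem hu) fun y hy => by
    rw [hus]
    exact (hcomm y hy).1.sub_left ((hcomm y hy).2.smul_left _)
  have h3 : w = ((‖w‖ : ℂ) / 2) • ((a + Complex.I • s) + star (a + Complex.I • s)) := by
    rw [hus]
    conv_lhs => rw [hwa]
    module
  rw [h3]
  exact (h1.add_left h2).smul_left _

variable [PartialOrder N] [StarOrderedRing N]

theorem exists_isLUB_of_monotone (e : N ≃ₗᵢ[ℂ] StrongDual ℂ X) {x : ℕ → N}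
    (hx : Monotone x) (h0 : ∀ n, 0 ≤ x n) (h1 : ∀ n, x n ≤ 1) : ∃ p, IsLUB (Set.range x) p := by
  have hn : ∀ n, ‖x n‖ ≤ 1 := fun n => (CStarAlgebra.norm_le_one_iff_of_nonneg _ (h0 n)).2 (h1 n)
  obtain ⟨p, hp⟩ := WStarTendsto.exists_of_bounded (e := e) (u := x) (hyperfilter ℕ) (C := 1)
    (Eventually.of_forall hn)
  refine ⟨p, ?_, ?_⟩
  · rintro _ ⟨n, rfl⟩
    refine sub_nonneg.1 ((hp.sub (WStarTendsto.const (x n))).nonneg (C := 1 + 1)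
      (Eventually.of_forall fun m => (norm_sub_le _ _).trans (add_le_add (hn m) (hn n))) ?_)
    exact ((eventually_ge_atTop n).filter_mono Nat.hyperfilter_le_atTop).mono
      fun m hm => sub_nonneg.2 (hx hm)
  · intro y hy
    refine sub_nonneg.1 (((WStarTendsto.const y).sub hp).nonneg (C := ‖y‖ + 1)
      (Eventually.of_forall fun m => (norm_sub_le _ _).trans (by gcongr; exact hn m)) ?_)
    exact Eventually.of_forall fun m => sub_nonneg.2 (hy ⟨m, rfl⟩)

/-- The least upper bound of a family is invariant under the inner automorphisms that fix the
family, so it commutes with the selfadjoint elements that commute with the family. -/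
theorem IsLUB.commute_of_isSelfAdjoint {ι : Type*} {x : ι → N} {p w : N}
    (hp : IsLUB (Set.range x) p) (hw : IsSelfAdjoint w) (h : ∀ n, Commute w (x n)) :
    Commute w p := by
  have key : ∀ u ∈ unitary N, (∀ n, Commute u (x n)) → p ≤ star u * p * u := by
    intro u hu hux
    refine hp.2 ?_
    rintro _ ⟨n, rfl⟩
    have h1 := star_left_conjugate_le_conjugate (hp.1 ⟨n, rfl⟩) u
    rwa [mul_assoc, ← (hux n).eq, ← mul_assoc, Unitary.star_mul_self_of_mem hu, one_mul] at h1
  refine commute_of_forall_unitary hw fun u hu huw => ?_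
  have h1 := key u hu fun n => huw _ (h n)
  have h2 := key (star u) (Unitary.star_mem hu) fun n => by
    have h3 := huw _ (h n)
    have : star u * (u * x n) * star u = star u * (x n * u) * star u := by rw [h3.eq]
    rw [← mul_assoc, Unitary.star_mul_self_of_mem hu, one_mul, mul_assoc, mul_assoc,
      Unitary.mul_star_self_of_mem hu, mul_one] at this
    exact this.symm
  have h4 := star_left_conjugate_le_conjugate h2 u
  rw [star_star] at h4
  have h5 : star u * (u * p * star u) * u = p := by
    have := Unitary.star_mul_self_of_mem hu
    calc star u * (u * p * star u) * u = (star u * u) * p * (star u * u) := by noncomm_ring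
      _ = p := by rw [this, one_mul, mul_one]
  rw [h5] at h4
  have h6 := le_antisymm h1 h4
  have : u * p = u * (star u * p * u) := by rw [← h6]
  rw [← mul_assoc, ← mul_assoc, Unitary.mul_star_self_of_mem hu, one_mul] at this
  exact this

/-- The spectral projection of `a` for the interval `(1/2, ∞)`, the supremum of the elements
`f n (a)` with `f n` increasing to the indicator function of this interval. The inequalities say
that `a ≥ 1/2` on the range of `p` and `a ≤ 1/2` on its complement, so that `2 a - p` is again in
`[0, 1]`. -/
theorem exists_spectral_projection (e : N ≃ₗᵢ[ℂ] StrongDual ℂ X) {a : N} (h0 : 0 ≤ a) (h1 : a ≤ 1) :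
    ∃ p : N, IsStarProjection p ∧ (∀ w, IsSelfAdjoint w → Commute w a → Commute w p) ∧
      p ≤ (2 : ℝ) • a ∧ (2 : ℝ) • a ≤ 1 + p := by
  have hasa : IsSelfAdjoint a := .of_nonneg h0
  let f : ℕ → ℝ → ℝ := fun n s => min 1 (max 0 (n * (2 * s - 1) - 1))
  have hfc : ∀ n, Continuous (f n) := fun n => by fun_prop
  let x : ℕ → N := fun n => cfc (f n) a
  have hx0 : ∀ n, 0 ≤ x n := fun n => cfc_nonneg fun s _ => by positivity
  have hx1 : ∀ n, x n ≤ 1 := fun n => cfc_le_one _ _ fun s _ => min_le_left _ _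
  have hmono : Monotone x := by
    intro n m hnm
    refine cfc_mono (fun s _ => ?_) (hfc n).continuousOn (hfc m).continuousOn
    have : (n : ℝ) ≤ m := by exact_mod_cast hnm
    simp only [f]
    rcases le_total 0 (2 * s - 1) with h | h
    · gcongr
    · rw [max_eq_left (by nlinarith [Nat.cast_nonneg (α := ℝ) n]),
        max_eq_left (by nlinarith [Nat.cast_nonneg (α := ℝ) m])]
  obtain ⟨p, hp⟩ := exists_isLUB_of_monotone e hmono hx0 hx1
  have hxp : ∀ n, x n ≤ p := fun n => hp.1 ⟨n, rfl⟩
  have hp0 : 0 ≤ p := (hx0 0).trans (hxp 0)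
  have hp1 : p ≤ 1 := hp.2 (by rintro _ ⟨n, rfl⟩; exact hx1 n)
  have hpsa : IsSelfAdjoint p := .of_nonneg hp0
  have hcomm : ∀ w, IsSelfAdjoint w → Commute w a → Commute w p := fun w hw hwa =>
    hp.commute_of_isSelfAdjoint hw fun n => (hwa.symm.cfc_real _).symm
  have hcf : ∀ g : ℝ → ℝ, Commute (cfc g a) p := fun g =>
    hcomm _ (cfc_predicate g a) ((Commute.refl a).cfc_real g)
  -- `f (2 n) = 1` on the support of `f n`, so `p ^ 2` is again an upper bound.
  have hsq : p ≤ p * p := by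
    refine hp.2 ?_
    rintro _ ⟨n, rfl⟩
    have h2 : x n ≤ x (2 * n) * x (2 * n) := by
      rw [← cfc_mul (f (2 * n)) (f (2 * n)) a (hfc _).continuousOn (hfc _).continuousOn]
      refine cfc_mono (fun s _ => ?_) (hfc n).continuousOn
        ((hfc _).mul (hfc _)).continuousOn
      simp only [f]
      rcases le_total ((n : ℝ) * (2 * s - 1)) 1 with h | h
      · rw [max_eq_left (by linarith), min_eq_right zero_le_one]
        exact mul_self_nonneg _
      · have : min 1 (max 0 (((2 * n : ℕ) : ℝ) * (2 * s - 1) - 1)) = 1 := by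
          rw [min_eq_left]
          refine le_max_of_le_right ?_
          push_cast
          linarith
        rw [this, mul_one]
        exact min_le_left _ _
    refine h2.trans ?_
    have hc : Commute (x (2 * n)) p := hcf _
    have h3 := Commute.mul_nonneg (sub_nonneg.2 (hxp (2 * n))) (add_nonneg hp0 (hx0 (2 * n)))
      ((((Commute.refl p).add_right hc.symm)).sub_left (hc.add_right (Commute.refl _)))
    have h4 : (p - x (2 * n)) * (p + x (2 * n)) = p * p - x (2 * n) * x (2 * n) := by
      rw [sub_mul, mul_add, mul_add, hc.eq]
      abel
    rw [h4] at h3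
    exact sub_nonneg.1 h3
  have hpp : IsStarProjection p := by
    refine ⟨le_antisymm ?_ hsq, hpsa⟩
    have h2 := Commute.mul_nonneg hp0 (sub_nonneg.2 hp1)
      ((Commute.one_right p).sub_right (Commute.refl p))
    rw [mul_sub, mul_one] at h2
    exact sub_nonneg.1 h2
  set b : N := cfc (fun s : ℝ => max 0 (1 - 2 * s)) a with hb
  set c : N := cfc (fun s : ℝ => max 0 (2 * s - 1)) a with hc
  have hb0 : 0 ≤ b := cfc_nonneg fun s _ => le_max_left _ _
  have hc0 : 0 ≤ c := cfc_nonneg fun s _ => le_max_left _ _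
  have hb1 : b ≤ 1 := cfc_le_one _ _ fun s hs => by
    have := spectrum_nonneg_of_nonneg h0 hs
    exact max_le zero_le_one (by linarith)
  have hc1 : c ≤ 1 := cfc_le_one _ _ fun s hs => by
    have h2 : s ≤ 1 := (CFC.le_one_iff (R := ℝ) a).1 h1 s hs
    exact max_le zero_le_one (by linarith)
  have hbp : Commute b p := hcf _
  have hcp : Commute c p := hcf _
  have hcb : c - b = (2 : ℝ) • a - 1 := by
    rw [hb, hc, ← cfc_sub _ _ a (by fun_prop) (by fun_prop)]
    have : (fun s : ℝ => max 0 (2 * s - 1) - max 0 (1 - 2 * s)) = fun s => (2 : ℝ) • id s - 1 := by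
      ext s
      simp only [id, smul_eq_mul]
      rcases le_total (2 * s) 1 with h | h
      · rw [max_eq_left (by linarith), max_eq_right (by linarith)]; ring
      · rw [max_eq_right (by linarith), max_eq_left (by linarith)]; ring
    rw [this, cfc_sub _ _ a (by fun_prop) (by fun_prop), cfc_smul (2 : ℝ) id a (by fun_prop),
      cfc_id ℝ a, cfc_const_one ℝ a]
  -- `b` is orthogonal to all `x n`, so conjugation by `1 - b` fixes them and cannot decrease `p`.
  have hpb : p * b = 0 := by
    have hxb : ∀ n, x n * b = 0 := by
      intro n
      rw [hb, ← cfc_mul (f n) _ a (hfc _).continuousOn (by fun_prop)]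
      have : (fun s : ℝ => f n s * max 0 (1 - 2 * s)) = fun _ => 0 := by
        ext s
        simp only [f]
        rcases le_total (2 * s) 1 with h | h
        · rw [max_eq_left (by nlinarith [Nat.cast_nonneg (α := ℝ) n]), min_eq_right zero_le_one,
            zero_mul]
        · rw [max_eq_left (by linarith : 1 - 2 * s ≤ 0), mul_zero]
      rw [this, cfc_const_zero ℝ a]
    have hbx : ∀ n, b * x n = 0 := fun n => by
      rw [← hxb n]; exact (cfc_commute_cfc _ _ a)
    have hle : p ≤ (1 - b) * p * (1 - b) := by
      refine hp.2 ?_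
      rintro _ ⟨n, rfl⟩
      have hsa : IsSelfAdjoint (1 - b) := (IsSelfAdjoint.one N).sub (.of_nonneg hb0)
      have h2 := hsa.conjugate_le_conjugate (hxp n)
      rwa [sub_mul, one_mul, hbx, sub_zero, mul_sub, mul_one, hxb, sub_zero] at h2
    have hpb0 : 0 ≤ p * b := Commute.mul_nonneg hp0 hb0 hbp.symm
    have h3 : 0 ≤ p * b * (1 - b) := Commute.mul_nonneg hpb0 (sub_nonneg.2 hb1)
      ((Commute.one_right _).sub_right (hbp.symm.mul_left (Commute.refl b)))
    have h4 : (1 - b) * p * (1 - b) = p - p * b - p * b * (1 - b) := by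
      rw [sub_mul, one_mul, hbp.eq]; noncomm_ring
    rw [h4] at hle
    refine le_antisymm ?_ hpb0
    have h5 : p * b + p * b * (1 - b) ≤ 0 := by
      have := sub_nonneg.2 hle
      rw [← neg_nonneg]
      convert this using 1
      abel
    exact (le_add_of_nonneg_right h3).trans h5
  -- `(1 - p) x n = 0`, and `x n c` is within `2 / n` of `c`.
  have hpc : (1 - p) * c = 0 := by
    have hxq : ∀ n, (1 - p) * x n = 0 := fun n => by
      rw [sub_mul, one_mul, (hpp.mul_right_and_mul_left_of_nonneg_of_le (hx0 n) (hxp n)).2,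
        sub_self]
    have hle : ∀ n : ℕ, ‖(1 - p) * c‖ ≤ 2 / ((n : ℝ) + 1) := by
      intro n
      have h2 : (1 - p) * c = (1 - p) * (c - x (n + 1) * c) := by
        rw [mul_sub, ← mul_assoc _ (x (n + 1)), hxq, zero_mul, sub_zero]
      rw [h2]
      refine (norm_mul_le _ _).trans ((mul_le_of_le_one_left (norm_nonneg _)
        hpp.one_sub.norm_le).trans ?_)
      rw [hc, ← cfc_mul (f _) _ a (hfc _).continuousOn (by fun_prop),
        ← cfc_sub _ _ a (by fun_prop) (by fun_prop)]
      refine norm_cfc_le (by positivity) fun s _ => ?_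
      have hn : (0 : ℝ) < n + 1 := by positivity
      simp only [f]
      push_cast
      rw [Real.norm_eq_abs, abs_le, le_div_iff₀ hn]
      rcases le_total (2 * s) 1 with h | h
      · rw [max_eq_left (by linarith : 2 * s - 1 ≤ 0)]
        simp only [mul_zero, sub_zero, neg_nonpos, zero_mul]
        exact ⟨by positivity, by norm_num⟩
      · rw [max_eq_right (by linarith : 0 ≤ 2 * s - 1)]
        rcases le_total (2 : ℝ) ((n + 1) * (2 * s - 1)) with h' | h'
        · rw [max_eq_right (by linarith), min_eq_left (by linarith)]
          simp only [one_mul, sub_self, neg_nonpos, zero_mul]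
          exact ⟨by positivity, by norm_num⟩
        · have h5 : 0 ≤ min 1 (max 0 (((n : ℝ) + 1) * (2 * s - 1) - 1)) := by positivity
          have h6 : min 1 (max 0 (((n : ℝ) + 1) * (2 * s - 1) - 1)) ≤ 1 := min_le_left _ _
          have h7 : 0 ≤ 2 * s - 1 := by linarith
          constructor
          · have : 0 ≤ 2 / ((n : ℝ) + 1) := by positivity
            nlinarith
          · nlinarith [mul_nonneg h5 h7]
    by_contra hne
    obtain ⟨n, hn⟩ := exists_nat_gt (2 / ‖(1 - p) * c‖)
    have hpos : 0 < ‖(1 - p) * c‖ := norm_pos_iff.2 hne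
    rw [div_lt_iff₀ hpos] at hn
    have := hle n
    rw [le_div_iff₀ (by positivity)] at this
    nlinarith
  have h2a : (2 : ℝ) • a = c - b + 1 := by rw [hcb, sub_add_cancel]
  have hqb : Commute p (1 - b) := (Commute.one_right _).sub_right hbp.symm
  refine ⟨p, hpp, hcomm, ?_, ?_⟩
  · have h2 := Commute.mul_nonneg (sub_nonneg.2 hp1) (sub_nonneg.2 hb1)
      ((Commute.one_left _).sub_left hqb)
    have h3 : (2 : ℝ) • a - p = (1 - p) * (1 - b) + c := by
      rw [mul_sub, mul_one, sub_mul, one_mul, hpb, sub_zero]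
      rw [h2a]
      abel
    rw [← sub_nonneg, h3]
    exact add_nonneg h2 hc0
  · have h2 := Commute.mul_nonneg hp0 (sub_nonneg.2 hc1)
      ((Commute.one_right _).sub_right hcp.symm)
    have h4 : p * c = c := by rw [sub_mul, one_mul, sub_eq_zero] at hpc; exact hpc.symm
    have h3 : 1 + p - (2 : ℝ) • a = p * (1 - c) + b := by
      rw [mul_sub, mul_one, h4]
      rw [h2a]
      abel
    rw [← sub_nonneg, h3]
    exact add_nonneg h2 hb0

/-- A selfadjoint element commuting with `S` is a norm limit of combinations of projections that
commute with `S`: the dyadic expansion of an element of `[0, 1]`. -/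
theorem mem_of_forall_isStarProjection (e : N ≃ₗᵢ[ℂ] StrongDual ℂ X) {S : Set N}
    (hS : ∀ s ∈ S, IsSelfAdjoint s) {V : Submodule ℂ N} (hV : IsClosed (V : Set N))
    (h : ∀ p, IsStarProjection p → (∀ s ∈ S, Commute s p) → p ∈ V) {x : N}
    (hx : IsSelfAdjoint x) (hxS : ∀ s ∈ S, Commute s x) : x ∈ V := by
  have approx : ∀ n : ℕ, ∀ a : N, 0 ≤ a → a ≤ 1 → (∀ s ∈ S, Commute s a) →
      ∃ y ∈ V, ‖a - y‖ ≤ (1 / 2) ^ n := by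
    intro n
    induction n with
    | zero =>
      intro a h0 h1 _
      refine ⟨0, V.zero_mem, ?_⟩
      simpa using (CStarAlgebra.norm_le_one_iff_of_nonneg _ h0).2 h1
    | succ n ih =>
      intro a h0 h1 haS
      obtain ⟨p, hp, hpc, hp1, hp2⟩ := exists_spectral_projection e h0 h1
      have hpS : ∀ s ∈ S, Commute s p := fun s hs => hpc s (hS s hs) (haS s hs)
      obtain ⟨y, hy, hyn⟩ := ih ((2 : ℝ) • a - p) (sub_nonneg.2 hp1)
        (sub_le_iff_le_add.2 hp2) fun s hs => ((haS s hs).smul_right _).sub_right (hpS s hs)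
      refine ⟨(1 / 2 : ℂ) • (p + y), V.smul_mem _ (V.add_mem (h p hp hpS) hy), ?_⟩
      have : a - (1 / 2 : ℂ) • (p + y) = (1 / 2 : ℂ) • ((2 : ℝ) • a - p - y) := by
        rw [← Complex.coe_smul]
        push_cast
        module
      rw [this, norm_smul, pow_succ']
      refine mul_le_mul (by simp) hyn (norm_nonneg _) (by norm_num)
  have unit : ∀ a : N, 0 ≤ a → a ≤ 1 → (∀ s ∈ S, Commute s a) → a ∈ V := by
    intro a h0 h1 haS
    rw [← SetLike.mem_coe, ← hV.closure_eq, Metric.mem_closure_iff]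
    intro ε hε
    obtain ⟨n, hn⟩ := exists_pow_lt_of_lt_one hε (by norm_num : (1 / 2 : ℝ) < 1)
    obtain ⟨y, hy, hyn⟩ := approx n a h0 h1 haS
    exact ⟨y, hy, by rw [dist_eq_norm]; exact hyn.trans_lt hn⟩
  have h1 : (1 : N) ∈ V := h 1 (.one N) fun s _ => Commute.one_right s
  set r : ℝ := ‖x‖ + 1 with hr
  have hr0 : 0 < r := by positivity
  have hle : x ≤ algebraMap ℝ N r := hx.le_algebraMap_norm_self.trans
    (algebraMap_mono N (by linarith))
  have hge : -algebraMap ℝ N r ≤ x := le_trans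
    (neg_le_neg (algebraMap_mono N (by linarith))) hx.neg_algebraMap_norm_le_self
  have hmem : (2 * r)⁻¹ • (x + algebraMap ℝ N r) ∈ V := by
    refine unit _ (smul_nonneg (by positivity) (by rwa [← neg_le_iff_add_nonneg])) ?_ ?_
    · have h2 : x + algebraMap ℝ N r ≤ (2 * r) • (1 : N) := by
        rw [two_mul, add_smul, ← Algebra.algebraMap_eq_smul_one]
        gcongr
      refine (smul_le_smul_of_nonneg_left h2 (by positivity)).trans_eq ?_
      rw [smul_smul, inv_mul_cancel₀ (by positivity), one_smul]
    · exact fun s hs => ((hxS s hs).add_right (Algebra.commute_algebraMap_right r s)).smul_right _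
  have h3 : x = ((2 * r : ℝ) : ℂ) • ((2 * r)⁻¹ • (x + algebraMap ℝ N r)) - (r : ℂ) • (1 : N) := by
    rw [Complex.coe_smul, Complex.coe_smul, smul_smul, mul_inv_cancel₀ (by positivity), one_smul,
      Algebra.algebraMap_eq_smul_one, add_sub_cancel_right]
  rw [h3]
  exact V.sub_mem (V.smul_mem _ hmem) (V.smul_mem _ h1)

end SpectralProjections

/-! ### Multiplication and normal functionals -/

section NormalMul

variable {N X : Type*} [CStarAlgebra N] [NormedAddCommGroup X] [NormedSpace ℂ X]
  {e : N ≃ₗᵢ[ℂ] StrongDual ℂ X}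

/-- Left multiplication by a projection preserves normality: along an ultrafilter of a ball
converging weak* to `0`, the limits `c` of `p x` and `d` of `(1 - p) x` satisfy `c + d = 0`,
`p c = c` and `p d = 0`. -/
theorem IsStarProjection.comp_mul_mem_normalFunctionals [CompleteSpace X] {p : N}
    (hp : IsStarProjection p) {ω : StrongDual ℂ N} (hω : ω ∈ normalFunctionals e) :
    ω.comp (ContinuousLinearMap.mul ℂ N p) ∈ normalFunctionals e := by
  obtain ⟨ξ, hξ⟩ := mem_normalFunctionals.1 hω
  refine mem_normalFunctionals_of_ultrafilter _ fun U hU hU0 => ?_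
  have bound : ∀ {r : N}, IsStarProjection r → ∀ᶠ x in (U : Filter N), ‖r * x‖ ≤ 1 := by
    intro r hr
    filter_upwards [hU] with x hx
    exact (norm_mul_le _ _).trans (mul_le_one₀ hr.norm_le (norm_nonneg _) hx)
  obtain ⟨c, hc⟩ := WStarTendsto.exists_of_bounded (e := e) U (bound hp)
  obtain ⟨d, hd⟩ := WStarTendsto.exists_of_bounded (e := e) U (bound hp.one_sub)
  have hpc : p * c = c := hc.projection_mul (bound hp) hp
    (Eventually.of_forall fun x => by rw [← mul_assoc, hp.isIdempotentElem.eq])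
  have hpd : (1 - p) * d = d := hd.projection_mul (bound hp.one_sub) hp.one_sub
    (Eventually.of_forall fun x => by rw [← mul_assoc, hp.one_sub.isIdempotentElem.eq])
  have hcd : c + d = 0 := ((hc.add hd).congr (w := id) (Eventually.of_forall fun x => by
    rw [← add_mul, add_sub_cancel, one_mul]; rfl)).unique hU0
  have hc0 : c = 0 := by
    rw [← hpc, eq_neg_of_add_eq_zero_left hcd, ← hpd, mul_neg, ← mul_assoc, hp.mul_one_sub_self,
      zero_mul, neg_zero]
  have := hc ξ
  rw [hc0] at this
  have hfun : ∀ x, (ω.comp (ContinuousLinearMap.mul ℂ N p)) x = e (p * x) ξ := fun x => hξ _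
  simpa [funext hfun] using this

/-- Left multiplication by any element preserves normality, since the projections span a norm-dense
subspace. -/
theorem comp_mul_mem_normalFunctionals [CompleteSpace X] (h : N) {ω : StrongDual ℂ N}
    (hω : ω ∈ normalFunctionals e) :
    ω.comp (ContinuousLinearMap.mul ℂ N h) ∈ normalFunctionals e := by
  let _ : PartialOrder N := CStarAlgebra.spectralOrder N
  have _ : StarOrderedRing N := CStarAlgebra.spectralOrderedRing N
  let L : N →L[ℂ] StrongDual ℂ N :=
    (ContinuousLinearMap.compL ℂ N N ℂ ω).comp (ContinuousLinearMap.mul ℂ N)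
  let V : Submodule ℂ N := (normalFunctionals e).comap (L : N →ₗ[ℂ] StrongDual ℂ N)
  have hV : IsClosed (V : Set N) := isClosed_normalFunctionals.preimage L.continuous
  have hsa : ∀ x : N, IsSelfAdjoint x → x ∈ V := fun x hx =>
    mem_of_forall_isStarProjection e (S := ∅) (by simp) hV
      (fun p hp _ => hp.comp_mul_mem_normalFunctionals hω) hx (by simp)
  have : h ∈ V := by
    rw [← realPart_add_I_smul_imaginaryPart h]
    exact V.add_mem (hsa _ (ℜ h).2) (V.smul_mem _ (hsa _ (ℑ h).2))
  exact this

end NormalMul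

/-! ### Orthogonal forms -/

section OrthogonalForm

variable {N X : Type*} [CStarAlgebra N] [NormedAddCommGroup X] [NormedSpace ℂ X]

theorem bilin_eq_zero_of_isSelfAdjoint {B : N →L[ℂ] N →L[ℂ] ℂ}
    (h : ∀ x y, IsSelfAdjoint x → IsSelfAdjoint y → B x y = 0) (x y : N) : B x y = 0 := by
  rw [← realPart_add_I_smul_imaginaryPart x, ← realPart_add_I_smul_imaginaryPart y]
  simp [h _ _ (ℜ x).2 (ℜ y).2, h _ _ (ℜ x).2 (ℑ y).2, h _ _ (ℑ x).2 (ℜ y).2, h _ _ (ℑ x).2 (ℑ y).2]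

variable {β : N →L[ℂ] N →L[ℂ] ℂ}

theorem orthogonal_form_projection
    (hβ : ∀ p q, IsStarProjection p → IsStarProjection q → p * q = 0 → β p q = 0)
    {p q : N} (hp : IsStarProjection p) (hq : IsStarProjection q) (hpq : Commute p q) :
    β p q = β (p * q) 1 := by
  have h1 : IsStarProjection (p * q) := hp.mul hq hpq
  have hc : Commute p (1 - q) := (Commute.one_right p).sub_right hpq
  have hc' : Commute (1 - p) q := (Commute.one_left q).sub_left hpq
  have h2 : IsStarProjection (p * (1 - q)) := hp.mul hq.one_sub hc
  have h3 : IsStarProjection ((1 - p) * q) := hp.one_sub.mul hq hc'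
  have e1 : β (p * (1 - q)) (p * q) = 0 := hβ _ _ h2 h1 (by
    rw [hpq.eq, mul_assoc, ← mul_assoc (1 - q), hq.one_sub_mul_self, zero_mul, mul_zero])
  have e2 : β (p * (1 - q)) ((1 - p) * q) = 0 := hβ _ _ h2 h3 (by
    rw [hc'.eq, mul_assoc, ← mul_assoc (1 - q), hq.one_sub_mul_self, zero_mul, mul_zero])
  have e3 : β (p * q) ((1 - p) * q) = 0 := hβ _ _ h1 h3 (by
    rw [hpq.eq, mul_assoc, ← mul_assoc p, hp.mul_one_sub_self, zero_mul, mul_zero])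
  have e4 : β (p * q) (1 - p * q) = 0 := hβ _ _ h1 h1.one_sub h1.mul_one_sub_self
  have hp' : p = p * q + p * (1 - q) := by noncomm_ring
  have hq' : q = p * q + (1 - p) * q := by noncomm_ring
  have h0 : β p q = β (p * q) (p * q) := by
    have : β p q = β (p * q + p * (1 - q)) (p * q + (1 - p) * q) := by rw [← hp', ← hq']
    rw [this, map_add, map_add, add_apply, add_apply,
      e1, e2, e3]
    ring
  rw [map_sub, sub_eq_zero] at e4
  rw [h0, e4]

/-- On commuting selfadjoint elements, an orthogonal form only depends on their product. -/
theorem orthogonal_form_commute (e : N ≃ₗᵢ[ℂ] StrongDual ℂ X)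
    (hβ : ∀ p q, IsStarProjection p → IsStarProjection q → p * q = 0 → β p q = 0)
    {x y : N} (hx : IsSelfAdjoint x) (hy : IsSelfAdjoint y) (hxy : Commute x y) :
    β x y = β (x * y) 1 := by
  let _ : PartialOrder N := CStarAlgebra.spectralOrder N
  have _ : StarOrderedRing N := CStarAlgebra.spectralOrderedRing N
  have h1 : ∀ q : N, IsStarProjection q → ∀ x : N, IsSelfAdjoint x → Commute q x →
      β x q = β (x * q) 1 := by
    intro q hq x hx hqx
    let T : N →L[ℂ] ℂ := β.flip q - (β.flip 1).comp ((ContinuousLinearMap.mul ℂ N).flip q)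
    have : x ∈ LinearMap.ker (T : N →ₗ[ℂ] ℂ) := by
      refine mem_of_forall_isStarProjection e (S := {q}) (by simpa using hq.isSelfAdjoint)
        T.isClosed_ker (fun p hp hpq => ?_) hx (by simpa using hqx)
      have := orthogonal_form_projection hβ hp hq (hpq q rfl).symm
      simpa [T, sub_eq_zero] using this
    simpa [T, sub_eq_zero] using this
  let T : N →L[ℂ] ℂ := β x - (β.flip 1).comp (ContinuousLinearMap.mul ℂ N x)
  have : y ∈ LinearMap.ker (T : N →ₗ[ℂ] ℂ) := by
    refine mem_of_forall_isStarProjection e (S := {x}) (by simpa using hx)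
      T.isClosed_ker (fun q hq hqx => ?_) hy (by simpa using hxy)
    have := h1 q hq x hx (hqx x rfl).symm
    simpa [T, sub_eq_zero] using this
  simpa [T, sub_eq_zero] using this

/-- The bilinear map `(x, y) ↦ β x y - ω (x y + y x) / 2`, where `ω x = β x 1`. For an
orthogonal form the second term is the symmetric part of `β`, whence the name. -/
noncomputable def skewPart (β : N →L[ℂ] N →L[ℂ] ℂ) : N →L[ℂ] N →L[ℂ] ℂ :=
  let M := (ContinuousLinearMap.compL ℂ N N ℂ (β.flip 1)).comp (ContinuousLinearMap.mul ℂ N)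
  β - (1 / 2 : ℂ) • (M + M.flip)

theorem skewPart_apply (x y : N) :
    skewPart β x y = β x y - (1 / 2) * (β (x * y) 1 + β (y * x) 1) := by
  simp [skewPart, mul_add]

theorem skewPart_eq_zero (e : N ≃ₗᵢ[ℂ] StrongDual ℂ X)
    (hβ : ∀ p q, IsStarProjection p → IsStarProjection q → p * q = 0 → β p q = 0)
    {x y : N} (hx : IsSelfAdjoint x) (hy : IsSelfAdjoint y) (hxy : Commute x y) :
    skewPart β x y = 0 := by
  rw [skewPart_apply, orthogonal_form_commute e hβ hx hy hxy, ← hxy.eq]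
  ring

theorem skewPart_swap (e : N ≃ₗᵢ[ℂ] StrongDual ℂ X)
    (hβ : ∀ p q, IsStarProjection p → IsStarProjection q → p * q = 0 → β p q = 0) (x y : N) :
    skewPart β x y = -skewPart β y x := by
  have h : ∀ z, IsSelfAdjoint z → skewPart β z z = 0 := fun z hz =>
    skewPart_eq_zero e hβ hz hz (Commute.refl z)
  have := bilin_eq_zero_of_isSelfAdjoint (B := skewPart β + (skewPart β).flip)
    (fun x y hx hy => by
      have := h _ (hx.add hy)
      simp only [map_add, add_apply, h _ hx, h _ hy] at this
      simp only [add_apply, ContinuousLinearMap.flip_apply]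
      linear_combination this) x y
  exact eq_neg_of_add_eq_zero_left (by simpa using this)

/-- The skew part is balanced over the center. For a central projection `z` this is because `z x`
and `(1 - z) y` have product zero. -/
theorem skewPart_mul_left (e : N ≃ₗᵢ[ℂ] StrongDual ℂ X)
    (hβ : ∀ p q, IsStarProjection p → IsStarProjection q → p * q = 0 → β p q = 0)
    {z : N} (hz : ∀ x, Commute z x) (x y : N) :
    skewPart β (z * x) y = skewPart β x (z * y) := by
  let _ : PartialOrder N := CStarAlgebra.spectralOrder N
  have _ : StarOrderedRing N := CStarAlgebra.spectralOrderedRing N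
  set γ := skewPart β with hγ
  let mulL := ContinuousLinearMap.mul ℂ N
  -- The case of a projection, extended from selfadjoint to all `x` and `y`.
  have hproj : ∀ p, IsStarProjection p → (∀ x, Commute p x) → ∀ x y, γ (p * x) y = γ x (p * y) := by
    intro p hp hpc x y
    have h0 : ∀ r s : N, IsSelfAdjoint r → IsSelfAdjoint s → r * s = 0 → (∀ x, Commute r x) →
        (∀ x, Commute s x) → ∀ x y, IsSelfAdjoint x → IsSelfAdjoint y → γ (r * x) (s * y) = 0 := by
      intro r s hr hs hrs hrc hsc x y hx hy
      have hsr : s * r = 0 := by rw [← (hrc s).eq, hrs]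
      refine skewPart_eq_zero e hβ ((hr.commute_iff hx).1 (hrc x))
        ((hs.commute_iff hy).1 (hsc y)) ?_
      have h1 : r * x * (s * y) = 0 := by
        rw [(hrc x).eq, mul_assoc, ← mul_assoc r, hrs, zero_mul, mul_zero]
      have h2 : s * y * (r * x) = 0 := by
        rw [(hsc y).eq, mul_assoc, ← mul_assoc s, hsr, zero_mul, mul_zero]
      exact h1.trans h2.symm
    have hpc' : ∀ x, Commute (1 - p) x := fun x => (Commute.one_left x).sub_left (hpc x)
    have := bilin_eq_zero_of_isSelfAdjoint
      (B := γ.comp (mulL p) - (γ.flip.comp (mulL p)).flip) (fun x y hx hy => by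
        have h1 := h0 p (1 - p) hp.isSelfAdjoint hp.one_sub.isSelfAdjoint hp.mul_one_sub_self
          hpc hpc' x y hx hy
        have h2 := h0 (1 - p) p hp.one_sub.isSelfAdjoint hp.isSelfAdjoint hp.one_sub_mul_self
          hpc' hpc x y hx hy
        simp only [sub_mul, one_mul, map_sub, sub_apply] at h1 h2
        simp only [sub_apply, ContinuousLinearMap.comp_apply,
          ContinuousLinearMap.flip_apply, mulL, ContinuousLinearMap.mul_apply']
        linear_combination h1 - h2) x y
    simpa [mulL, sub_eq_zero] using this
  have hsa : ∀ z, IsSelfAdjoint z → (∀ x, Commute z x) → γ (z * x) y = γ x (z * y) := by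
    intro z hzsa hzc
    let T : N →L[ℂ] ℂ := (γ.flip y).comp (mulL.flip x) - (γ x).comp (mulL.flip y)
    have : z ∈ LinearMap.ker (T : N →ₗ[ℂ] ℂ) := by
      refine mem_of_forall_isStarProjection e (S := {s | IsSelfAdjoint s}) (fun s hs => hs)
        T.isClosed_ker (fun p hp hpS => ?_) hzsa (fun s _ => (hzc s).symm)
      have hpc : ∀ w, Commute p w := fun w => by
        rw [← realPart_add_I_smul_imaginaryPart w]
        exact (hpS _ (ℜ w).2).symm.add_right ((hpS _ (ℑ w).2).symm.smul_right _)
      have := hproj p hp hpc x y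
      simpa [T, mulL, sub_eq_zero] using this
    simpa [T, mulL, sub_eq_zero] using this
  have hstar : ∀ x, Commute (star z) x := fun x => by
    have := (hz (star x)).star_star
    rwa [star_star] at this
  have hre : ∀ x, Commute (ℜ z : N) x := fun x => by
    rw [realPart_apply_coe]
    exact ((hz x).add_left (hstar x)).smul_left _
  have him : ∀ x, Commute (ℑ z : N) x := fun x => by
    rw [imaginaryPart_apply_coe]
    exact (((hz x).sub_left (hstar x)).smul_left _).smul_left _
  rw [← realPart_add_I_smul_imaginaryPart z]
  simp [add_mul, hsa _ (ℜ z).2 hre, hsa _ (ℑ z).2 him]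

theorem skewPart_central (e : N ≃ₗᵢ[ℂ] StrongDual ℂ X)
    (hβ : ∀ p q, IsStarProjection p → IsStarProjection q → p * q = 0 → β p q = 0)
    {z : N} (hz : ∀ x, Commute z x) (y : N) : skewPart β z y = 0 := by
  have h1 : ∀ y, IsSelfAdjoint y → skewPart β 1 y = 0 := fun y hy =>
    skewPart_eq_zero e hβ (.one N) hy (Commute.one_left y)
  rw [← mul_one z, skewPart_mul_left e hβ hz, ← realPart_add_I_smul_imaginaryPart (z * y)]
  simp [h1 _ (ℜ (z * y)).2, h1 _ (ℑ (z * y)).2]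

end OrthogonalForm

/-! ### Matrix units and the center-valued trace -/

section MatrixUnits

variable {N : Type*} [CStarAlgebra N]

/-- The data of a `2 × 2` system of matrix units `p = e₁₁`, `q = e₂₂`, `v = e₂₁`, `v* = e₁₂` whose
diagonal corner `p N p` is commutative. -/
structure IsTwoByTwoSystem (p q v : N) : Prop where
  projection_fst : IsStarProjection p
  projection_snd : IsStarProjection q
  star_mul_self : star v * v = p
  mul_star_self : v * star v = q
  mul_eq_zero : p * q = 0
  add_eq_one : p + q = 1
  commute_corner : ∀ x y : N, Commute (p * x * p) (p * y * p)

theorem IsTypeITwo.exists_isTwoByTwoSystem (h : IsTypeITwo N) :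
    ∃ p q v : N, IsTwoByTwoSystem p q v := by
  obtain ⟨p, q, hp, hq, ⟨v, hv, hv'⟩, hpq, h1⟩ := h
  exact ⟨p, q, v, hp.1, hq.1, hv, hv', hpq, h1, hp.2⟩

/-- The center-valued trace `x ↦ x₁₁ + x₂₂` of a system of matrix units, as the sum of `w x w*` over
all matrix units `w`. -/
def centerTrace (p q v : N) : N →ₗ[ℂ] N where
  toFun x := p * x * p + q * x * q + v * x * star v + star v * x * v
  map_add' x y := by noncomm_ring
  map_smul' c x := by simp [smul_add]

theorem centerTrace_apply (p q v x : N) :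
    centerTrace p q v x = p * x * p + q * x * q + v * x * star v + star v * x * v := rfl

namespace IsTwoByTwoSystem

variable {p q v : N} (h : IsTwoByTwoSystem p q v)
include h

theorem v_mul_p : v * p = v := by
  have hp := h.projection_fst
  have h1 : star (v * (1 - p)) * (v * (1 - p)) = 0 := by
    rw [star_mul, mul_assoc, ← mul_assoc (star v), h.star_mul_self, hp.mul_one_sub_self, mul_zero]
  have h2 := CStarRing.star_mul_self_eq_zero_iff _ |>.1 h1
  rw [mul_sub, mul_one, sub_eq_zero] at h2
  exact h2.symm

theorem q_mul_v : q * v = v := by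
  rw [← h.mul_star_self, mul_assoc, h.star_mul_self, h.v_mul_p]

theorem p_mul_v : p * v = 0 := by
  rw [← h.q_mul_v, ← mul_assoc, h.mul_eq_zero, zero_mul]

theorem q_mul_p : q * p = 0 := by
  have := congrArg star h.mul_eq_zero
  rwa [star_mul, star_zero, h.projection_fst.isSelfAdjoint.star_eq,
    h.projection_snd.isSelfAdjoint.star_eq] at this

theorem v_mul_q : v * q = 0 := by
  rw [← h.v_mul_p, mul_assoc, h.mul_eq_zero, mul_zero]

theorem v_mul_v : v * v = 0 := by
  nth_rw 1 [← h.v_mul_p]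
  rw [mul_assoc, h.p_mul_v, mul_zero]

theorem p_mul_star : p * star v = star v := by
  simpa [h.projection_fst.isSelfAdjoint.star_eq] using congrArg star h.v_mul_p

theorem star_mul_q : star v * q = star v := by
  simpa [h.projection_snd.isSelfAdjoint.star_eq] using congrArg star h.q_mul_v

theorem star_mul_p : star v * p = 0 := by
  simpa [h.projection_fst.isSelfAdjoint.star_eq] using congrArg star h.p_mul_v

theorem q_mul_star : q * star v = 0 := by
  simpa [h.projection_snd.isSelfAdjoint.star_eq] using congrArg star h.v_mul_q

theorem star_mul_star : star v * star v = 0 := by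
  simpa using congrArg star h.v_mul_v

/-- The first diagonal entry `θ` of the trace, with the trace itself equal to `θ + v θ v*`. -/
theorem exists_centerTrace_eq (x : N) :
    ∃ θ, θ = p * x * p + star v * x * v ∧ p * θ * p = θ ∧
      centerTrace p q v x = θ + v * θ * star v := by
  refine ⟨_, rfl, ?_, ?_⟩
  · have hp := h.projection_fst.isIdempotentElem.eq
    calc p * (p * x * p + star v * x * v) * p
        = (p * p) * x * (p * p) + (p * star v) * x * (v * p) := by noncomm_ring
      _ = _ := by rw [hp, h.p_mul_star, h.v_mul_p]
  · have : v * (p * x * p + star v * x * v) * star v =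
        (v * p) * x * (p * star v) + (v * star v) * x * (v * star v) := by noncomm_ring
    rw [centerTrace_apply, this, h.v_mul_p, h.p_mul_star, h.mul_star_self]
    abel

theorem centerTrace_mul_p (x : N) :
    centerTrace p q v x * p = p * x * p + star v * x * v := by
  obtain ⟨θ, hθ, hθp, ht⟩ := h.exists_centerTrace_eq x
  have hp := h.projection_fst.isIdempotentElem.eq
  rw [← hθ, ht, add_mul, mul_assoc _ _ p, h.star_mul_p, mul_zero, add_zero, ← hθp, mul_assoc,
    mul_assoc, hp, mul_assoc]

theorem eq_sum_entries (x : N) :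
    x = p * x * p + (p * x * v) * star v + v * (star v * x * p) +
      v * (star v * x * v) * star v := by
  calc x = (p + q) * x * (p + q) := by rw [h.add_eq_one, one_mul, mul_one]
    _ = (p + v * star v) * x * (p + v * star v) := by rw [h.mul_star_self]
    _ = _ := by noncomm_ring

theorem commute_centerTrace (x y : N) : Commute (centerTrace p q v x) y := by
  obtain ⟨θ, -, hθp, ht⟩ := h.exists_centerTrace_eq x
  have hp := h.projection_fst.isIdempotentElem.eq
  have hpθ : p * θ = θ := by rw [← hθp, ← mul_assoc, ← mul_assoc, hp]
  have hθp' : θ * p = θ := by rw [← hθp, mul_assoc, hp]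
  have hθv : θ * v = 0 := by rw [← hθp', mul_assoc, h.p_mul_v, mul_zero]
  have hvθ : star v * θ = 0 := by rw [← hpθ, ← mul_assoc, h.star_mul_p, zero_mul]
  set t := centerTrace p q v x
  have hv : Commute t v := by
    have h1 : t * v = v * θ := by
      rw [ht, add_mul, hθv, zero_add, mul_assoc, h.star_mul_self, mul_assoc, hθp']
    have h2 : v * t = v * θ := by
      rw [ht, mul_add, ← mul_assoc, ← mul_assoc, h.v_mul_v, zero_mul, zero_mul, add_zero]
    exact h1.trans h2.symm
  have hvs : Commute t (star v) := by
    have h1 : t * star v = θ * star v := by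
      rw [ht, add_mul, mul_assoc, h.star_mul_star, mul_zero, add_zero]
    have h2 : star v * t = θ * star v := by
      rw [ht, mul_add, hvθ, zero_add, ← mul_assoc, ← mul_assoc, h.star_mul_self, hpθ]
    exact h1.trans h2.symm
  have htp : t * p = θ := by
    rw [ht, add_mul, hθp', mul_assoc, h.star_mul_p, mul_zero, add_zero]
  have hpt : p * t = θ := by
    rw [ht, mul_add, hpθ, ← mul_assoc, ← mul_assoc, h.p_mul_v, zero_mul, zero_mul, add_zero]
  have hc : ∀ y, Commute t (p * y * p) := fun y => by
    have h1 : t * (p * y * p) = θ * (p * y * p) := by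
      rw [← htp]
      calc t * (p * y * p) = t * ((p * p) * y * p) := by rw [hp]
        _ = _ := by noncomm_ring
    have h2 : (p * y * p) * t = (p * y * p) * θ := by
      rw [← hpt]
      calc (p * y * p) * t = p * y * (p * p) * t := by rw [hp]
        _ = _ := by noncomm_ring
    have h3 : Commute θ (p * y * p) := by
      rw [← hθp]
      exact h.commute_corner θ y
    exact (h1.trans h3.eq).trans h2.symm
  have e1 : p * y * v = p * (y * v) * p := by
    rw [mul_assoc p, mul_assoc p, mul_assoc y, h.v_mul_p]
  have e2 : star v * y * p = p * (star v * y) * p := by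
    rw [← mul_assoc p, h.p_mul_star]
  have e3 : star v * y * v = p * (star v * y * v) * p := by
    rw [mul_assoc p, mul_assoc (star v * y), h.v_mul_p, mul_assoc (star v), ← mul_assoc p,
      h.p_mul_star]
  rw [h.eq_sum_entries y, e1, e2, e3]
  exact (((hc _).add_right ((hc _).mul_right hvs)).add_right (hv.mul_right (hc _))).add_right
    ((hv.mul_right (hc _)).mul_right hvs)

/-- Every element is a combination of `1`, `p`, `v`, `v*` with central coefficients. -/
theorem exists_central_coefficients (x : N) : ∃ a b c d : N, (∀ y, Commute a y) ∧
    (∀ y, Commute b y) ∧ (∀ y, Commute c y) ∧ (∀ y, Commute d y) ∧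
    x = a + b * p + c * v + d * star v := by
  have hp := h.projection_fst.isIdempotentElem.eq
  set T := centerTrace p q v with hT
  have key : ∀ y, p * y * p = y → T y * p = y := fun y hy => by
    have h1 : star v * y * v = 0 := by
      rw [← hy, ← mul_assoc, ← mul_assoc, h.star_mul_p, zero_mul, zero_mul, zero_mul]
    rw [hT, h.centerTrace_mul_p, h1, add_zero, hy]
  have keyv : ∀ y, p * y * p = y → T y * v = v * y := fun y hy => by
    calc T y * v = v * p * T y := by rw [(h.commute_centerTrace y v).eq, h.v_mul_p]
      _ = v * y := by rw [mul_assoc, ← (h.commute_centerTrace y p).eq, key y hy]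
  have keys : ∀ y, p * y * p = y → T y * star v = y * star v := fun y hy => by
    nth_rw 1 [← h.p_mul_star]
    rw [← mul_assoc, key y hy]
  have keyq : ∀ y, p * y * p = y → T y * q = v * y * star v := fun y hy => by
    rw [← h.mul_star_self, ← mul_assoc, keyv y hy]
  have e1 : p * (p * x * p) * p = p * x * p := by
    calc _ = (p * p) * x * (p * p) := by noncomm_ring
      _ = _ := by rw [hp]
  have e2 : p * (p * x * v) * p = p * x * v := by
    calc _ = (p * p) * x * (v * p) := by noncomm_ring
      _ = _ := by rw [hp, h.v_mul_p]
  have e3 : p * (star v * x * p) * p = star v * x * p := by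
    calc _ = (p * star v) * x * (p * p) := by noncomm_ring
      _ = _ := by rw [hp, h.p_mul_star]
  have e4 : p * (star v * x * v) * p = star v * x * v := by
    calc _ = (p * star v) * x * (v * p) := by noncomm_ring
      _ = _ := by rw [h.v_mul_p, h.p_mul_star]
  refine ⟨T (star v * x * v), T (p * x * p) - T (star v * x * v), T (star v * x * p),
    T (p * x * v), h.commute_centerTrace _,
    fun y => (h.commute_centerTrace _ y).sub_left (h.commute_centerTrace _ y),
    h.commute_centerTrace _, h.commute_centerTrace _, ?_⟩
  have hsum : T (star v * x * v) = T (star v * x * v) * p + T (star v * x * v) * q := by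
    rw [← mul_add, h.add_eq_one, mul_one]
  rw [sub_mul, keyv _ e3, keys _ e2, key _ e1]
  conv_rhs => enter [1, 1, 1]; rw [hsum]
  rw [keyq _ e4]
  conv_lhs => rw [h.eq_sum_entries x]
  abel

/-- The trace property: the four products of entries that occur commute in the corner `p N p`. -/
theorem centerTrace_mul_comm (x y : N) :
    centerTrace p q v (x * y) = centerTrace p q v (y * x) := by
  obtain ⟨θ, hθ, -, ht⟩ := h.exists_centerTrace_eq (x * y)
  obtain ⟨η, hη, -, hs⟩ := h.exists_centerTrace_eq (y * x)
  have hp := h.projection_fst.isIdempotentElem.eq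
  have expand : ∀ x y : N, p * (x * y) * p + star v * (x * y) * v =
      (p * x * p) * (p * y * p) + (p * (x * v) * p) * (p * (star v * y) * p) +
        (p * (star v * x) * p) * (p * (y * v) * p) +
        (p * (star v * x * v) * p) * (p * (star v * y * v) * p) := by
    intro x y
    have e1 : p * (x * v) * p = p * x * v := by
      rw [mul_assoc p, mul_assoc x, h.v_mul_p, mul_assoc]
    have e1' : p * (y * v) * p = p * y * v := by
      rw [mul_assoc p, mul_assoc y, h.v_mul_p, mul_assoc]
    have e2 : p * (star v * x) * p = star v * x * p := by rw [← mul_assoc p, h.p_mul_star]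
    have e2' : p * (star v * y) * p = star v * y * p := by rw [← mul_assoc p, h.p_mul_star]
    have e3 : ∀ y, p * (star v * y * v) * p = star v * y * v := fun y => by
      calc _ = (p * star v) * y * (v * p) := by noncomm_ring
        _ = _ := by rw [h.v_mul_p, h.p_mul_star]
    rw [e1, e1', e2, e2', e3, e3]
    calc _ = p * x * (p + q) * y * p + star v * x * (p + q) * y * v := by
          rw [h.add_eq_one]; noncomm_ring
      _ = p * x * (p * p + v * star v) * y * p + star v * x * (p * p + v * star v) * y * v := by
          rw [hp, h.mul_star_self]
      _ = _ := by noncomm_ring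
  have : θ = η := by
    rw [hθ, hη, expand, expand, (h.commute_corner x y).eq, (h.commute_corner (x * v) _).eq,
      (h.commute_corner (star v * x) _).eq, (h.commute_corner (star v * x * v) _).eq]
    abel
  rw [ht, hs, this]

theorem centerTrace_one : centerTrace p q v 1 = (2 : ℂ) • (1 : N) := by
  rw [centerTrace_apply]
  simp only [mul_one]
  rw [h.projection_fst.isIdempotentElem.eq, h.projection_snd.isIdempotentElem.eq,
    h.mul_star_self, h.star_mul_self, h.add_eq_one, add_assoc, add_comm q p, h.add_eq_one]
  module

/-- The matrix units are permuted by the involution. -/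
theorem centerTrace_eq_sum_star_mul (x : N) : centerTrace p q v x =
    star p * x * p + star q * x * q + star v * x * v + star (star v) * x * star v := by
  rw [centerTrace_apply, h.projection_fst.isSelfAdjoint.star_eq,
    h.projection_snd.isSelfAdjoint.star_eq, star_star]
  abel

theorem centerTrace_nonneg [PartialOrder N] [StarOrderedRing N] {x : N} (hx : 0 ≤ x) :
    0 ≤ centerTrace p q v x := by
  rw [h.centerTrace_eq_sum_star_mul]
  exact add_nonneg (add_nonneg (add_nonneg (star_left_conjugate_nonneg hx p)
    (star_left_conjugate_nonneg hx q)) (star_left_conjugate_nonneg hx v))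
    (star_left_conjugate_nonneg hx (star v))

/-- An additive function vanishes if it vanishes on the central multiples of `1`, `p`, `v`, `v*`. -/
theorem additive_eq_zero {T : N → ℂ} (hadd : ∀ x y, T (x + y) = T x + T y)
    (hT : ∀ k, (∀ y, Commute k y) → T k = 0 ∧ T (k * p) = 0 ∧ T (k * v) = 0 ∧ T (k * star v) = 0)
    (x : N) : T x = 0 := by
  obtain ⟨a, b, c, d, ha, hb, hc, hd, rfl⟩ := h.exists_central_coefficients x
  rw [hadd, hadd, hadd, (hT a ha).1, (hT b hb).2.1, (hT c hc).2.2.1, (hT d hd).2.2.2]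
  simp

/-- In type `I₂`, a skew-symmetric form that is balanced over the center is a functional of the
commutator. The functional is `x ↦ -∑ γ (x w) w*`, summed over the matrix units `w`, and the
identity has to be checked only on the pairs `(p, v)`, `(p, v*)`, `(v, v*)` with one central
coefficient. -/
theorem exists_apply_commutator {γ : N →L[ℂ] N →L[ℂ] ℂ} (hskew : ∀ x y, γ x y = -γ y x)
    (hbal : ∀ z, (∀ x, Commute z x) → ∀ x y, γ (z * x) y = γ x (z * y))
    (hcen : ∀ z, (∀ x, Commute z x) → ∀ y, γ z y = 0) :
    ∃ τ : N →ₗ[ℂ] ℂ, ∀ x y, γ x y = (1 / 2) * τ (y * x - x * y) := by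
  have hp := h.projection_fst.isIdempotentElem.eq
  let τ : N →ₗ[ℂ] ℂ :=
    { toFun := fun x => -(γ (x * p) p + γ (x * q) q + γ (x * star v) v + γ (x * v) (star v))
      map_add' := fun x y => by simp [add_mul]; ring
      map_smul' := fun c x => by simp; ring }
  have hτ : ∀ x, τ x = -(γ (x * p) p + γ (x * q) q + γ (x * star v) v + γ (x * v) (star v)) :=
    fun x => rfl
  refine ⟨τ, ?_⟩
  have hdiag : ∀ k, (∀ x, Commute k x) → ∀ b, γ (k * b) b = 0 := fun k hk b => by
    have h1 := hbal k hk b b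
    have h2 := hskew b (k * b)
    rw [h2] at h1
    exact self_eq_neg.1 h1
  have hswap : ∀ k, (∀ x, Commute k x) → ∀ b c, γ (k * b) c = -γ (k * c) b := fun k hk b c => by
    rw [hbal k hk, hskew]
  have hq : ∀ k, (∀ x, Commute k x) → ∀ y, γ (k * q) y = -γ (k * p) y := fun k hk y => by
    have h1 := hcen k hk y
    have h2 : k = k * p + k * q := by rw [← mul_add, h.add_eq_one, mul_one]
    rw [h2, map_add, add_apply] at h1
    exact eq_neg_of_add_eq_zero_right h1
  have hpv : ∀ k, (∀ x, Commute k x) → γ (k * p) v = (1 / 2) * τ (k * v) := fun k hk => by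
    rw [hτ, mul_assoc k v p, mul_assoc k v q, mul_assoc k v (star v), mul_assoc k v v, h.v_mul_p,
      h.v_mul_q, h.mul_star_self, h.v_mul_v, mul_zero, map_zero, hq k hk, hswap k hk v p]
    simp only [zero_apply]
    ring
  have hps : ∀ k, (∀ x, Commute k x) → γ (k * p) (star v) = -((1 / 2) * τ (k * star v)) :=
    fun k hk => by
    rw [hτ, mul_assoc k _ p, mul_assoc k _ q, mul_assoc k _ (star v), mul_assoc k _ v, h.star_mul_p,
      h.star_mul_q, h.star_mul_star, h.star_mul_self, mul_zero, map_zero, hswap k hk (star v) q,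
      hq k hk]
    simp only [zero_apply]
    ring
  have hvs : ∀ k, (∀ x, Commute k x) → γ (k * v) (star v) = (1 / 2) * τ (k * p - k * q) :=
    fun k hk => by
    rw [map_sub, hτ, hτ]
    simp only [mul_assoc k]
    rw [hp, h.mul_eq_zero, h.p_mul_star, h.p_mul_v, h.q_mul_p, h.projection_snd.isIdempotentElem.eq,
      h.q_mul_star, h.q_mul_v, mul_zero, map_zero, hdiag k hk, hdiag k hk,
      hswap k hk (star v) v]
    simp only [zero_apply]
    ring
  let D : N → N → ℂ := fun x y => γ x y - (1 / 2) * τ (y * x - x * y)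
  have hDadd : ∀ x x' y, D (x + x') y = D x y + D x' y := fun x x' y => by
    simp only [D, mul_add, add_mul, map_add, map_sub, add_apply]
    ring
  have hDskew : ∀ x y, D x y = -D y x := fun x y => by
    simp only [D, hskew x y, map_sub]
    ring
  have hDadd' : ∀ x y y', D x (y + y') = D x y + D x y' := fun x y y' => by
    rw [hDskew, hDadd, hDskew y, hDskew y']
    ring
  have hDbal : ∀ k l, (∀ x, Commute k x) → (∀ x, Commute l x) → ∀ b c,
      D (k * b) (l * c) = D (k * l * b) c := fun k l hk hl b c => by
    have hkl : ∀ x, Commute (k * l) x := fun x => (hk x).mul_left (hl x)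
    have e1 : γ (k * b) (l * c) = γ (k * l * b) c := by
      rw [← hbal l hl, ← mul_assoc, (hk l).eq]
    have e2 : l * c * (k * b) = c * (k * l * b) := by
      rw [(hl c).eq, mul_assoc, ← mul_assoc l, (hk l).eq]
    have e3 : k * b * (l * c) = k * l * b * c := by
      rw [mul_assoc, ← mul_assoc b, ← (hl b).eq]
      noncomm_ring
    simp only [D, e1, e2, e3]
  have hDcen : ∀ k, (∀ x, Commute k x) → ∀ y, D k y = 0 := fun k hk y => by
    simp only [D, hcen k hk, (hk y).eq, sub_self, map_zero, mul_zero]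
  have hDdiag : ∀ k, (∀ x, Commute k x) → ∀ b, D (k * b) b = 0 := fun k hk b => by
    have h1 : b * (k * b) = k * b * b := by rw [← mul_assoc, (hk b).eq]
    simp only [D, hdiag k hk, h1, sub_self, map_zero, mul_zero]
  have hDswap : ∀ k, (∀ x, Commute k x) → ∀ b c, D (k * b) c = -D (k * c) b := fun k hk b c => by
    have := hDbal 1 k (fun x => Commute.one_left x) hk b c
    rw [one_mul, one_mul] at this
    rw [← this, hDskew]
  have hDpv : ∀ k, (∀ x, Commute k x) → D (k * p) v = 0 := fun k hk => by
    simp only [D]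
    rw [hpv k hk, ← mul_assoc v, ← (hk v).eq, mul_assoc k v p, h.v_mul_p, mul_assoc k p v,
      h.p_mul_v, mul_zero, sub_zero, sub_self]
  have hDps : ∀ k, (∀ x, Commute k x) → D (k * p) (star v) = 0 := fun k hk => by
    simp only [D]
    rw [hps k hk, ← mul_assoc (star v), ← (hk (star v)).eq, mul_assoc k (star v) p, h.star_mul_p,
      mul_assoc k p (star v), h.p_mul_star, mul_zero, zero_sub, map_neg]
    ring
  have hDvs : ∀ k, (∀ x, Commute k x) → D (k * v) (star v) = 0 := fun k hk => by
    simp only [D]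
    rw [hvs k hk, ← mul_assoc (star v), ← (hk (star v)).eq, mul_assoc k (star v) v,
      h.star_mul_self, mul_assoc k v (star v), h.mul_star_self, sub_self]
  have hDone : ∀ k, (∀ x, Commute k x) → ∀ b, D b k = 0 := fun k hk b => by
    rw [hDskew, hDcen k hk, neg_zero]
  have hDp : ∀ k, (∀ x, Commute k x) → ∀ y, D (k * p) y = 0 := fun k hk =>
    h.additive_eq_zero (hDadd' _) fun l hl => by
      have hkl : ∀ x, Commute (k * l) x := fun x => (hk x).mul_left (hl x)
      rw [hDbal k l hk hl, hDbal k l hk hl, hDbal k l hk hl]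
      exact ⟨hDone l hl _, hDdiag _ hkl _, hDpv _ hkl, hDps _ hkl⟩
  have hDv : ∀ k, (∀ x, Commute k x) → ∀ y, D (k * v) y = 0 := fun k hk =>
    h.additive_eq_zero (hDadd' _) fun l hl => by
      have hkl : ∀ x, Commute (k * l) x := fun x => (hk x).mul_left (hl x)
      rw [hDbal k l hk hl, hDbal k l hk hl, hDbal k l hk hl]
      refine ⟨hDone l hl _, ?_, hDdiag _ hkl _, hDvs _ hkl⟩
      rw [hDswap _ hkl, hDpv _ hkl, neg_zero]
  have hDs : ∀ k, (∀ x, Commute k x) → ∀ y, D (k * star v) y = 0 := fun k hk =>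
    h.additive_eq_zero (hDadd' _) fun l hl => by
      have hkl : ∀ x, Commute (k * l) x := fun x => (hk x).mul_left (hl x)
      rw [hDbal k l hk hl, hDbal k l hk hl, hDbal k l hk hl]
      refine ⟨hDone l hl _, ?_, ?_, hDdiag _ hkl _⟩
      · rw [hDswap _ hkl, hDps _ hkl, neg_zero]
      · rw [hDswap _ hkl, hDvs _ hkl, neg_zero]
  intro x y
  have := h.additive_eq_zero (T := fun x => D x y) (fun x x' => hDadd x x' y)
    (fun k hk => ⟨hDcen k hk y, hDp k hk y, hDv k hk y, hDs k hk y⟩) x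
  exact sub_eq_zero.1 this

end IsTwoByTwoSystem

end MatrixUnits

/-! ### Positive functionals dominated by a normal one -/

section Domination

variable {N X : Type*} [CStarAlgebra N] [NormedAddCommGroup X] [NormedSpace ℂ X]
  {e : N ≃ₗᵢ[ℂ] StrongDual ℂ X}

theorem re_map_star_of_nonneg {φ : N →ₗ[ℂ] ℂ} (hφ : ∀ x, 0 ≤ φ (star x * x)) (x : N) :
    (φ (star x)).re = (φ x).re := by
  have h1 : ∀ x, (φ (star x * x)).im = 0 := fun x => (Complex.nonneg_iff.1 (hφ x)).2.symm
  have h2 := h1 (Complex.I • x + 1)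
  have h3 : star (Complex.I • x + 1) * (Complex.I • x + 1) =
      star x * x - Complex.I • star x + Complex.I • x + 1 := by
    simp only [star_add, star_smul, star_one, Complex.star_def, Complex.conj_I, add_mul, mul_add,
      smul_mul_assoc, mul_smul_comm, one_mul, mul_one, neg_smul, neg_mul, smul_add, smul_neg,
      smul_smul, Complex.I_mul_I, one_smul, neg_neg]
    abel
  have h4 := h1 1
  rw [star_one, one_mul] at h4
  rw [h3] at h2
  simp [h1 x, h4] at h2
  linarith

/-- A positive functional dominated by a normal one is normal. If `h` minimizes
`ω (h* h) - 2 re (φ h)` up to `δ`, then `φ` differs from the normal functional `x ↦ ω (h* x)` by at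
most `√(δ ω (x* x))` at `x`, so `φ` is a norm limit of normal functionals. -/
theorem exists_mem_normalFunctionals_of_le [CompleteSpace X] {ω : StrongDual ℂ N}
    (hω : ω ∈ normalFunctionals e) {φ : N →ₗ[ℂ] ℂ} (hφ : ∀ x, 0 ≤ φ (star x * x))
    (hle : ∀ x, φ (star x * x) ≤ ω (star x * x)) :
    ∃ φ' ∈ normalFunctionals e, ∀ x, φ' x = φ x := by
  have hω0 : ∀ x, 0 ≤ ω (star x * x) := fun x => (hφ x).trans (hle x)
  let Q : N → ℝ := fun h => (ω (star h * h)).re - 2 * (φ h).re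
  have hbdd : BddBelow (Set.range Q) := by
    refine ⟨-(φ 1).re, ?_⟩
    rintro _ ⟨h, rfl⟩
    -- `φ (h* h) - 2 re (φ h) + φ 1 = φ ((h - 1)* (h - 1)) ≥ 0`, and `φ (h* h) ≤ ω (h* h)`.
    have h1 := (Complex.nonneg_iff.1 (hφ (h - 1))).1
    have h2 : star (h - 1) * (h - 1) = star h * h - star h - h + 1 := by
      rw [star_sub, star_one]; noncomm_ring
    rw [h2] at h1
    simp [re_map_star_of_nonneg hφ] at h1
    have h3 := (Complex.le_def.1 (hle h)).1
    simp only [Q]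
    linarith
  have approx : ∀ δ > 0, ∃ h : N, ∀ x, ‖ω (star h * x) - φ x‖ ^ 2 ≤ δ * (‖ω‖ * ‖x‖ ^ 2) := by
    intro δ hδ
    obtain ⟨_, ⟨h, rfl⟩, hh⟩ := exists_lt_of_csInf_lt (Set.range_nonempty Q)
      (lt_add_of_pos_right (sInf (Set.range Q)) hδ)
    have hmin : ∀ y, Q h - δ ≤ Q y := fun y => by
      have := csInf_le hbdd ⟨y, rfl⟩
      linarith
    refine ⟨h, fun x => ?_⟩
    have hreal : ∀ x, (ω (star h * x) - φ x).re ^ 2 ≤ δ * (ω (star x * x)).re := by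
      intro x
      have h1 : ∀ s : ℝ, 0 ≤ (ω (star x * x)).re * (s * s) +
          2 * (ω (star h * x) - φ x).re * s + δ := by
        intro s
        have h2 := hmin (h + (s : ℂ) • x)
        have h3 : star (h + (s : ℂ) • x) * (h + (s : ℂ) • x) =
            star h * h + (s : ℂ) • (star h * x) + (s : ℂ) • star (star h * x) +
              (s : ℂ) • (s : ℂ) • (star x * x) := by
          simp only [star_add, star_smul, Complex.star_def, Complex.conj_ofReal, add_mul, mul_add,
            smul_mul_assoc, mul_smul_comm, star_mul, star_star, smul_add]
          abel
        have h4 := re_map_star_of_nonneg (φ := (ω : N →ₗ[ℂ] ℂ)) hω0 (star h * x)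
        simp only [ContinuousLinearMap.coe_coe] at h4
        simp only [Q, h3, map_add, map_smul, smul_eq_mul, Complex.add_re, Complex.re_ofReal_mul,
          h4] at h2
        simp only [Complex.sub_re]
        linarith
      have h2 := discrim_le_zero h1
      rw [discrim] at h2
      linarith
    -- Multiplying `x` by a phase reduces the modulus to the real part.
    obtain ⟨c, hc, hcz⟩ : ∃ c : ℂ, ‖c‖ = 1 ∧ c * (ω (star h * x) - φ x) =
        (‖ω (star h * x) - φ x‖ : ℂ) := by
      obtain ⟨c, hc, h⟩ := RCLike.exists_norm_eq_mul_self (ω (star h * x) - φ x)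
      exact ⟨c, hc, h.symm⟩
    have h1 := hreal (c • x)
    have h2 : ω (star h * c • x) - φ (c • x) = (‖ω (star h * x) - φ x‖ : ℂ) := by
      rw [← hcz, mul_smul_comm, map_smul, map_smul, smul_eq_mul, smul_eq_mul, mul_sub]
    rw [h2, Complex.ofReal_re] at h1
    refine h1.trans ?_
    gcongr
    refine (Complex.re_le_norm _).trans ((ω.le_opNorm _).trans ?_)
    rw [CStarRing.norm_star_mul_self, norm_smul, hc, one_mul, pow_two]
  have approx' : ∀ ε > 0, ∃ h : N, ∀ x, ‖ω (star h * x) - φ x‖ ≤ ε * ‖x‖ := by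
    intro ε hε
    obtain ⟨h, hh⟩ := approx (ε ^ 2 / (‖ω‖ + 1)) (by positivity)
    refine ⟨h, fun x => abs_le_of_sq_le_sq' ((hh x).trans ?_) (by positivity) |>.2⟩
    rw [mul_pow, ← mul_assoc]
    gcongr
    rw [div_mul_eq_mul_div, div_le_iff₀ (by positivity)]
    gcongr
    linarith
  obtain ⟨h, hh⟩ := approx' 1 one_pos
  let φ' : StrongDual ℂ N := φ.mkContinuous (1 + ‖ω‖ * ‖h‖) fun x => by
    have h1 : φ x = ω (star h * x) - (ω (star h * x) - φ x) := by ring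
    rw [h1]
    refine (norm_sub_le _ _).trans ?_
    have h2 : ‖ω (star h * x)‖ ≤ ‖ω‖ * ‖h‖ * ‖x‖ := by
      refine (ω.le_opNorm _).trans ?_
      rw [mul_assoc, ← norm_star h]
      gcongr
      exact norm_mul_le _ _
    linarith [hh x]
  refine ⟨φ', ?_, fun x => rfl⟩
  rw [← SetLike.mem_coe, ← isClosed_normalFunctionals.closure_eq, Metric.mem_closure_iff]
  intro ε hε
  obtain ⟨h, hh⟩ := approx' (ε / 2) (half_pos hε)
  refine ⟨_, comp_mul_mem_normalFunctionals (star h) hω, ?_⟩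
  rw [dist_comm, dist_eq_norm]
  refine (ContinuousLinearMap.opNorm_le_bound _ (half_pos hε).le fun x => ?_).trans_lt
    (half_lt_self hε)
  exact hh x

end Domination

/-! ### Positive functionals with the same form -/

section Positivity

variable {N : Type*} [CStarAlgebra N]

/-- The complex-linear extension of a real functional on the selfadjoint elements. -/
noncomputable def selfAdjointExtension (g : selfAdjoint N →ₗ[ℝ] ℝ) : N →ₗ[ℂ] ℂ where
  toFun x := g (ℜ x) + Complex.I * g (ℑ x)
  map_add' x y := by simp; ring
  map_smul' c x := by
    simp only [realPart_smul, imaginaryPart_smul, map_add, map_sub, map_smul, smul_eq_mul,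
      RingHom.id_apply]
    conv_rhs => rw [← Complex.re_add_im c]
    push_cast
    linear_combination (-(c.im : ℂ) * g (ℑ x)) * Complex.I_sq

theorem selfAdjointExtension_coe (g : selfAdjoint N →ₗ[ℝ] ℝ) (x : selfAdjoint N) :
    selfAdjointExtension g x = g x := by
  simp [selfAdjointExtension]

namespace IsTwoByTwoSystem

variable [PartialOrder N] [StarOrderedRing N] {p q v : N}

/-- If `a`, `b` have the same trace `t`, invertible in the center, then the elements
`x = a^(1/2) w b^(1/2) t^(-1/2)`, for `w` running over the matrix units, satisfy `∑ x* x = b` and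
`∑ x x* = a`. -/
theorem re_nonneg_of_centerTrace_eq_of_le (h : IsTwoByTwoSystem p q v) {φ ψ : N →ₗ[ℂ] ℂ}
    (hpos : ∀ x, 0 ≤ (φ (star x * x) + ψ (x * star x)).re) {a b : N} (ha : 0 ≤ a) (hb : 0 ≤ b)
    (hab : centerTrace p q v a = centerTrace p q v b) {c : ℝ} (hc : 0 < c)
    (hca : algebraMap ℝ N c ≤ centerTrace p q v a) : 0 ≤ (φ b + ψ a).re := by
  set t := centerTrace p q v a with ht
  have ht0 : 0 ≤ t := h.centerTrace_nonneg ha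
  have htsa : IsSelfAdjoint t := .of_nonneg ht0
  have hspec : ∀ r ∈ spectrum ℝ t, c ≤ r := (algebraMap_le_iff_le_spectrum (R := ℝ)).1 hca
  -- The function `r ↦ r^(-1/2)` on `[c, ∞)`, extended continuously to the real line.
  let f : ℝ → ℝ := fun r => (√(max r c))⁻¹
  have hf : Continuous f := by
    refine Continuous.inv₀ (by fun_prop) fun r => ?_
    have : 0 < max r c := lt_max_of_lt_right hc
    positivity
  set s : N := cfc f t with hs
  have hssa : IsSelfAdjoint s := cfc_predicate f t
  have hscomm : ∀ y, Commute s y := fun y => (h.commute_centerTrace a y).cfc_real f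
  have hst : s * s * t = 1 := by
    have e1 : s * s = cfc (fun r => f r * f r) t :=
      (cfc_mul f f t hf.continuousOn hf.continuousOn).symm
    have e2 : s * s * t = cfc (fun r => f r * f r * r) t := by
      rw [cfc_mul (fun r => f r * f r) (fun r => r) t (hf.mul hf).continuousOn (by fun_prop), ← e1,
        cfc_id' ℝ t]
    rw [e2, ← cfc_const_one ℝ t]
    refine cfc_congr fun r hr => ?_
    have h1 := hspec r hr
    simp only [f, max_eq_left h1]
    rw [← mul_inv, Real.mul_self_sqrt (by linarith), inv_mul_cancel₀ (by linarith)]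
  set A := CFC.sqrt a with hA
  set B := CFC.sqrt b with hB
  have hAA : A * A = a := CFC.sqrt_mul_sqrt_self a
  have hBB : B * B = b := CFC.sqrt_mul_sqrt_self b
  have hAsa : star A = A := (CFC.sqrt_nonneg a).star_eq
  have hBsa : star B = B := (CFC.sqrt_nonneg b).star_eq
  have e1 : ∀ w, star (A * w * B * s) * (A * w * B * s) = s * s * (B * (star w * a * w) * B) := by
    intro w
    rw [star_mul, star_mul, star_mul, hAsa, hBsa, hssa.star_eq, ← (hscomm (A * w * B)).eq, ← hAA]
    calc _ = s * (B * (star w * A) * s) * (A * w * B) := by noncomm_ring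
      _ = _ := by rw [← (hscomm (B * (star w * A))).eq]; noncomm_ring
  have e2 : ∀ w, (A * w * B * s) * star (A * w * B * s) = s * s * (A * (w * b * star w) * A) := by
    intro w
    rw [star_mul, star_mul, star_mul, hAsa, hBsa, hssa.star_eq, ← (hscomm (A * w * B)).eq, ← hBB]
    calc _ = s * (A * w * B * s) * (B * (star w * A)) := by noncomm_ring
      _ = _ := by rw [← (hscomm (A * w * B)).eq]; noncomm_ring
  have f1 : s * s * (B * t * B) = b := by
    rw [← (h.commute_centerTrace a B).eq, ← ht, ← hBB, mul_assoc t, ← mul_assoc, hst, one_mul]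
  have f2 : s * s * (A * t * A) = a := by
    rw [← (h.commute_centerTrace a A).eq, ← ht, ← mul_assoc, ← mul_assoc, hst, one_mul, hAA]
  have g1 : b = s * s * (B * (star p * a * p) * B) + s * s * (B * (star q * a * q) * B) +
      s * s * (B * (star v * a * v) * B) + s * s * (B * (star (star v) * a * star v) * B) := by
    conv_lhs => rw [← f1, ht, h.centerTrace_eq_sum_star_mul]
    noncomm_ring
  have g2 : a = s * s * (A * (p * b * star p) * A) + s * s * (A * (q * b * star q) * A) +
      s * s * (A * (v * b * star v) * A) + s * s * (A * (star v * b * star (star v)) * A) := by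
    conv_lhs => rw [← f2, hab, centerTrace_apply]
    rw [h.projection_fst.isSelfAdjoint.star_eq, h.projection_snd.isSelfAdjoint.star_eq, star_star]
    noncomm_ring
  have key := add_nonneg (add_nonneg (add_nonneg (hpos (A * p * B * s)) (hpos (A * q * B * s)))
    (hpos (A * v * B * s))) (hpos (A * star v * B * s))
  simp only [e1, e2] at key
  have k1 := congrArg (fun x => (φ x).re) g1
  have k2 := congrArg (fun x => (ψ x).re) g2
  simp only [map_add, Complex.add_re] at key k1 k2 ⊢
  linarith

/-- Two positive elements `a`, `b` with the same trace are approximated by `a + ε` and `b + ε`,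
whose common trace is invertible. -/
theorem re_nonneg_of_centerTrace_eq (h : IsTwoByTwoSystem p q v) {φ ψ : N →ₗ[ℂ] ℂ}
    (hpos : ∀ x, 0 ≤ (φ (star x * x) + ψ (x * star x)).re) {a b : N} (ha : 0 ≤ a) (hb : 0 ≤ b)
    (hab : centerTrace p q v a = centerTrace p q v b) : 0 ≤ (φ b + ψ a).re := by
  have key : ∀ ε : ℝ, 0 < ε → 0 ≤ (φ b + ψ a).re + ε * (φ 1 + ψ 1).re := by
    intro ε hε
    have h1 : (0 : N) ≤ ε • (1 : N) := smul_nonneg hε.le zero_le_one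
    have h2 : centerTrace p q v (ε • (1 : N)) = (2 * ε) • (1 : N) := by
      rw [← Complex.coe_smul ε, map_smul, h.centerTrace_one, ← Complex.coe_smul, smul_smul]
      push_cast
      rw [mul_comm]
    have := h.re_nonneg_of_centerTrace_eq_of_le hpos (add_nonneg ha h1) (add_nonneg hb h1)
      (by rw [map_add, map_add, hab]) (c := 2 * ε) (by positivity) (by
        rw [map_add, h2, Algebra.algebraMap_eq_smul_one]
        exact le_add_of_nonneg_left (h.centerTrace_nonneg ha))
    rw [← Complex.coe_smul ε, map_add, map_add, map_smul, map_smul] at this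
    simp only [Complex.add_re, smul_eq_mul, Complex.re_ofReal_mul] at this ⊢
    linarith
  by_contra! hneg
  rcases le_or_gt (φ 1 + ψ 1).re 0 with hK | hK
  · linarith [key 1 one_pos]
  · have := key (-(φ b + ψ a).re / (2 * (φ 1 + ψ 1).re)) (div_pos (by linarith) (by linarith))
    have h1 : -(φ b + ψ a).re / (2 * (φ 1 + ψ 1).re) * (φ 1 + ψ 1).re = -(φ b + ψ a).re / 2 := by
      field_simp
    linarith

/-- A form `φ₀ (x* x) + ψ₀ (x x*)` that takes nonnegative values is given by positive functionals.
On the pairs `(b, a)` with the same trace, `φ₀ b + ψ₀ a` is positive, and the M. Riesz extension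
theorem extends it to a positive functional of all pairs of selfadjoint elements. -/
theorem exists_nonneg_functionals (h : IsTwoByTwoSystem p q v) {φ₀ ψ₀ : N →ₗ[ℂ] ℂ}
    (hpos : ∀ x, 0 ≤ φ₀ (star x * x) + ψ₀ (x * star x)) :
    ∃ φ ψ : N →ₗ[ℂ] ℂ, (∀ x, 0 ≤ φ (star x * x)) ∧ (∀ x, 0 ≤ ψ (star x * x)) ∧
      ∀ x, φ (star x * x) + ψ (x * star x) = φ₀ (star x * x) + ψ₀ (x * star x) := by
  have hpos' : ∀ x, 0 ≤ (φ₀ (star x * x) + ψ₀ (x * star x)).re := fun x =>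
    (Complex.nonneg_iff.1 (hpos x)).1
  let E := selfAdjoint N × selfAdjoint N
  let T : selfAdjoint N →ₗ[ℝ] N :=
    (centerTrace p q v).restrictScalars ℝ ∘ₗ (selfAdjoint.submodule ℝ N).subtype
  let ρ : (N →ₗ[ℂ] ℂ) → selfAdjoint N →ₗ[ℝ] ℝ := fun φ =>
    Complex.reLm ∘ₗ φ.restrictScalars ℝ ∘ₗ (selfAdjoint.submodule ℝ N).subtype
  let D : Submodule ℝ E := LinearMap.ker
    (T ∘ₗ LinearMap.fst ℝ _ _ - T ∘ₗ LinearMap.snd ℝ _ _ : E →ₗ[ℝ] N)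
  have hD : ∀ z : E, z ∈ D ↔ centerTrace p q v z.1 = centerTrace p q v z.2 := fun z => by
    rw [LinearMap.mem_ker, LinearMap.sub_apply, sub_eq_zero]
    rfl
  let f : E →ₗ.[ℝ] ℝ :=
    ⟨D, (ρ φ₀ ∘ₗ LinearMap.fst ℝ _ _ + ρ ψ₀ ∘ₗ LinearMap.snd ℝ _ _ : E →ₗ[ℝ] ℝ) ∘ₗ D.subtype⟩
  let s : PointedCone ℝ E :=
    { carrier := {z | 0 ≤ (z.1 : N) ∧ 0 ≤ (z.2 : N)}
      add_mem' := fun {x y} hx hy => ⟨add_nonneg hx.1 hy.1, add_nonneg hx.2 hy.2⟩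
      zero_mem' := ⟨le_rfl, le_rfl⟩
      smul_mem' := fun c x hx => ⟨smul_nonneg c.2 hx.1, smul_nonneg c.2 hx.2⟩ }
  have hs : ∀ z : E, z ∈ s ↔ 0 ≤ (z.1 : N) ∧ 0 ≤ (z.2 : N) := fun z => Iff.rfl
  obtain ⟨g, hgf, hgs⟩ := riesz_extension s f (fun x hx => by
      have := h.re_nonneg_of_centerTrace_eq hpos' ((hs _).1 hx).2 ((hs _).1 hx).1
        ((hD _).1 x.2).symm
      rw [Complex.add_re] at this
      exact this)
    (fun y => by
      let r : ℝ := ‖(y.1 : N)‖ + ‖(y.2 : N)‖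
      refine ⟨⟨(r • 1, r • 1), (hD _).2 rfl⟩, ?_⟩
      have hr : ∀ z : selfAdjoint N, ‖(z : N)‖ ≤ r → 0 ≤ r • (1 : N) + z := fun z hz => by
        have h1 := z.2.neg_algebraMap_norm_le_self
        have h2 : algebraMap ℝ N ‖(z : N)‖ ≤ algebraMap ℝ N r := algebraMap_mono N hz
        rw [← Algebra.algebraMap_eq_smul_one]
        exact neg_le_iff_add_nonneg'.1 ((neg_le_neg h2).trans h1)
      exact (hs _).2 ⟨hr y.1 (le_add_of_nonneg_right (norm_nonneg _)),
        hr y.2 (le_add_of_nonneg_left (norm_nonneg _))⟩)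
  let G₁ : selfAdjoint N →ₗ[ℝ] ℝ := g ∘ₗ LinearMap.inl ℝ _ _
  let G₂ : selfAdjoint N →ₗ[ℝ] ℝ := g ∘ₗ LinearMap.inr ℝ _ _
  have hsm : ∀ x : N, selfAdjointExtension G₁ (star x * x) =
      G₁ ⟨star x * x, IsSelfAdjoint.star_mul_self x⟩ := fun x =>
    selfAdjointExtension_coe G₁ ⟨star x * x, IsSelfAdjoint.star_mul_self x⟩
  have hsm2 : ∀ x : N, selfAdjointExtension G₂ (star x * x) =
      G₂ ⟨star x * x, IsSelfAdjoint.star_mul_self x⟩ := fun x =>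
    selfAdjointExtension_coe G₂ ⟨star x * x, IsSelfAdjoint.star_mul_self x⟩
  have hms : ∀ x : N, selfAdjointExtension G₂ (x * star x) =
      G₂ ⟨x * star x, IsSelfAdjoint.mul_star_self x⟩ := fun x =>
    selfAdjointExtension_coe G₂ ⟨x * star x, IsSelfAdjoint.mul_star_self x⟩
  refine ⟨selfAdjointExtension G₁, selfAdjointExtension G₂, fun x => ?_, fun x => ?_, fun x => ?_⟩
  · rw [hsm, Complex.zero_le_real]
    exact hgs _ ((hs _).2 ⟨star_mul_self_nonneg x, le_rfl⟩)
  · rw [hsm2, Complex.zero_le_real]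
    exact hgs _ ((hs _).2 ⟨le_rfl, star_mul_self_nonneg x⟩)
  · rw [hsm, hms]
    let z : E := (⟨star x * x, IsSelfAdjoint.star_mul_self x⟩,
      ⟨x * star x, IsSelfAdjoint.mul_star_self x⟩)
    have h1 := hgf ⟨z, (hD _).2 (h.centerTrace_mul_comm _ _)⟩
    have h2 : G₁ z.1 + G₂ z.2 = g z := by
      change g (z.1, 0) + g (0, z.2) = g z
      rw [← map_add]
      exact congrArg g (Prod.ext (add_zero _) (zero_add _))
    have h3 : f ⟨z, (hD _).2 (h.centerTrace_mul_comm _ _)⟩ =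
        (φ₀ (star x * x) + ψ₀ (x * star x)).re := by
      rw [Complex.add_re]
      rfl
    rw [← Complex.ofReal_add, h2]
    refine (congrArg Complex.ofReal (h1.trans h3)).trans ?_
    exact (Complex.eq_re_of_ofReal_le (by exact_mod_cast hpos x)).symm

end IsTwoByTwoSystem

end Positivity

/-! ### Weak* continuous orthogonal fields -/

section WStarContinuous

variable {N X H : Type*} [CStarAlgebra N]
  [NormedAddCommGroup X] [NormedSpace ℂ X]
  [NormedAddCommGroup H] [InnerProductSpace ℂ H]

theorem IsWStarContinuous.tendsto_inner {e : N ≃ₗᵢ[ℂ] StrongDual ℂ X} {F : N →ₗ[ℂ] H}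
    (hF : IsWStarContinuous e F) {ι : Type*} {u : ι → N} {l : Filter ι} {a : N}
    (hu : WStarTendsto e u l a) (z : H) :
    Tendsto (fun i => inner ℂ z (F (u i))) l (𝓝 (inner ℂ z (F a))) := by
  have h1 : Tendsto u l (@nhds N (weakStarTopology e) a) := by
    rw [nhds_induced, tendsto_comap_iff]
    exact (WeakBilin.tendsto_iff_forall_eval_tendsto _
      ContinuousLinearMap.coe_injective).2 fun ξ => hu ξ
  have h2 := (@Continuous.tendsto N (WeakSpace ℂ H) (weakStarTopology e) _ _ hF a).comp h1
  exact ((WeakBilin.eval_continuous (topDualPairing ℂ H).flip (innerSL ℂ z)).tendsto _).comp h2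

/-- Norm convergence implies weak* convergence, so the graph of a field is closed. -/
theorem IsWStarContinuous.continuous [CompleteSpace H] {e : N ≃ₗᵢ[ℂ] StrongDual ℂ X}
    {F : N →ₗ[ℂ] H} (hF : IsWStarContinuous e F) : Continuous F := by
  refine F.continuous_of_seq_closed_graph fun u x y hu hy => ?_
  refine ext_inner_left ℂ fun z => ?_
  exact tendsto_nhds_unique ((innerSL ℂ z).continuous.tendsto y |>.comp hy)
    (hF.tendsto_inner (WStarTendsto.of_tendsto hu) z)

/-- A sesquilinear form is determined by its values on the diagonal. -/
theorem sesq_eq_zero_of_diagonal {S : N → N → ℂ} (h : ∀ x, S x x = 0)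
    (hadd : ∀ x y z, S (x + y) z = S x z + S y z) (hadd' : ∀ x y z, S x (y + z) = S x y + S x z)
    (hsmul : ∀ (c : ℂ) x y, S (c • x) y = c * S x y)
    (hsmul' : ∀ (c : ℂ) x y, S x (c • y) = star c * S x y) (x y : N) : S x y = 0 := by
  have h1 := h (x + y)
  have h2 := h (x + Complex.I • y)
  simp only [hadd, hadd', hsmul, hsmul', h, Complex.star_def, Complex.conj_I] at h1 h2
  linear_combination (1 / 2) * h1 + (Complex.I / 2) * h2 + ((S x y - S y x) / 2) * Complex.I_sq

end WStarContinuous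

theorem theorem4 {N X H : Type*} [CStarAlgebra N]
    [NormedAddCommGroup X] [NormedSpace ℂ X] [CompleteSpace X]
    [NormedAddCommGroup H] [InnerProductSpace ℂ H] [CompleteSpace H]
    (e : N ≃ₗᵢ[ℂ] StrongDual ℂ X) (hN : IsTypeITwo N)
    (F : N →ₗ[ℂ] H) (hF : IsOrthogonalField F) (hFc : IsWStarContinuous e F) :
    IsStationaryField e F := by
  let _ : PartialOrder N := CStarAlgebra.spectralOrder N
  have _ : StarOrderedRing N := CStarAlgebra.spectralOrderedRing N
  obtain ⟨p, q, v, h⟩ := hN.exists_isTwoByTwoSystem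
  let Fc : N →L[ℂ] H := ⟨F, hFc.continuous⟩
  let β : N →L[ℂ] N →L[ℂ] ℂ := LinearMap.mkContinuous₂
    (LinearMap.mk₂ ℂ (fun x y => inner ℂ (F (star y)) (F x))
      (fun x x' y => by simp) (fun c x y => by simp)
      (fun x y y' => by simp) (fun c x y => by simp [mul_comm]))
    (‖Fc‖ * ‖Fc‖) fun x y => by
      refine (norm_inner_le_norm _ _).trans ?_
      have h1 := Fc.le_opNorm (star y)
      rw [norm_star] at h1
      calc ‖Fc (star y)‖ * ‖Fc x‖ ≤ (‖Fc‖ * ‖y‖) * (‖Fc‖ * ‖x‖) := by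
            gcongr
            exact Fc.le_opNorm x
        _ = _ := by ring
  have hβ : ∀ x y, β x y = inner ℂ (F (star y)) (F x) := fun x y => rfl
  have horth : ∀ p q, IsStarProjection p → IsStarProjection q → p * q = 0 → β p q = 0 := by
    intro p q hp hq hpq
    have hqp : q * p = 0 := by
      simpa [hp.isSelfAdjoint.star_eq, hq.isSelfAdjoint.star_eq] using congrArg star hpq
    rw [hβ, hq.isSelfAdjoint.star_eq]
    exact hF q p hq hp hqp
  let ω : StrongDual ℂ N := β.flip 1
  have hω : ω ∈ normalFunctionals e := mem_normalFunctionals_of_ultrafilter ω fun U _ hU => by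
    have := hFc.tendsto_inner hU (F (star 1))
    rw [map_zero, inner_zero_right] at this
    exact this
  obtain ⟨τ, hτ⟩ := h.exists_apply_commutator (skewPart_swap e horth)
    (fun z hz => skewPart_mul_left e horth hz) (fun z hz => skewPart_central e horth hz)
  let φ₀ : N →ₗ[ℂ] ℂ := (1 / 2 : ℂ) • ((ω : N →ₗ[ℂ] ℂ) + τ)
  let ψ₀ : N →ₗ[ℂ] ℂ := (1 / 2 : ℂ) • ((ω : N →ₗ[ℂ] ℂ) - τ)
  have h0 : ∀ x y, φ₀ (star y * x) + ψ₀ (x * star y) = inner ℂ (F y) (F x) := fun x y => by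
    have h1 := hτ x (star y)
    rw [skewPart_apply, hβ, star_star, map_sub] at h1
    have h2 : ∀ x, φ₀ x = (1 / 2) * (β x 1 + τ x) := fun x => rfl
    have h3 : ∀ x, ψ₀ x = (1 / 2) * (β x 1 - τ x) := fun x => rfl
    rw [h2, h3]
    linear_combination -h1
  have hpos : ∀ x, 0 ≤ φ₀ (star x * x) + ψ₀ (x * star x) := fun x => by
    have h1 : inner ℂ (F x) (F x) = ((‖F x‖ ^ 2 : ℝ) : ℂ) := by
      push_cast
      exact inner_self_eq_norm_sq_to_K _
    rw [h0, h1]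
    exact Complex.zero_le_real.2 (sq_nonneg _)
  obtain ⟨φ, ψ, hφ, hψ, hφψ⟩ := h.exists_nonneg_functionals hpos
  have hform : ∀ x y, φ (star y * x) + ψ (x * star y) = inner ℂ (F y) (F x) := fun x y => by
    refine sub_eq_zero.1 (sesq_eq_zero_of_diagonal
      (S := fun x y => φ (star y * x) + ψ (x * star y) - inner ℂ (F y) (F x))
      (fun x => ?_) (fun x y z => ?_) (fun x y z => ?_) (fun c x y => ?_) (fun c x y => ?_) x y)
    · simp only [hφψ, h0, sub_self]
    · simp only [mul_add, add_mul, map_add, inner_add_right]; ring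
    · simp only [mul_add, add_mul, map_add, star_add, inner_add_left]; ring
    · simp only [mul_smul_comm, smul_mul_assoc, map_smul, inner_smul_right, smul_eq_mul]; ring
    · simp only [star_smul, mul_smul_comm, smul_mul_assoc, map_smul, inner_smul_left, smul_eq_mul,
        Complex.star_def]
      ring
  have hsum : ∀ x, ω x = φ x + ψ x := fun x => by
    have := hform x 1
    rw [star_one, one_mul, mul_one] at this
    rw [this]
    change inner ℂ (F (star 1)) (F x) = _
    rw [star_one]
  obtain ⟨φ', hφ', hφe⟩ := exists_mem_normalFunctionals_of_le hω hφ fun x => by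
    rw [hsum]; exact le_add_of_nonneg_right (hψ x)
  obtain ⟨ψ', hψ', hψe⟩ := exists_mem_normalFunctionals_of_le hω hψ fun x => by
    rw [hsum]; exact le_add_of_nonneg_left (hφ x)
  refine ⟨φ', ψ', ⟨mem_normalFunctionals.1 hφ', fun x => ?_⟩,
    ⟨mem_normalFunctionals.1 hψ', fun x => ?_⟩, fun x y => ?_⟩
  · rw [hφe]; exact hφ x
  · rw [hψe]; exact hψ x
  · rw [hφe, hψe, hform]
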